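/- Fix $n$ Boolean variables $x_1,\dots,x_n$. The fully polarized random 2-CNF formula $\Phi_m(n,2,0)=C_1\wedge\dots\wedge C_m$ consists of $m$ independent random clauses: for each clause, one picks an ordered pair $(v_1,v_2)$ of distinct indices in $\{1,\dots,n\}$ uniformly at random, and an independent fair coin decides whether the clause is $x_{v_1}\vee x_{v_2}$ or $\neg x_{v_1}\vee\neg x_{v_2}$. The implication digraph of a 2-CNF formula has the $2n$ literals $x_i,\neg x_i$ as vertices, and each clause $y\vee z$ contributes the two arcs $\neg y\Rightarrow z$ and $\neg z\Rightarrow y$. A bicycle is a directed cycle that contains both $x_i$ and $\neg x_i$ for some $i$. A unicycle is a bicycle of even length in which exactly one variable $x$ is repeated, this variable occurring precisely twice, once as $x$ and once as $\neg x$, at diametrically opposed points of the cycle. **Proposition.** Let $\varepsilon=\varepsilon(n)$ satisfy $0<\varepsilon(n)<\tfrac12$ for all large $n$ and $n^{-0.1}(\ln n)^{0.9}=o(\varepsilon(n))$ as $n\to\infty$, and let $m=m(n)$ be integers with $m(n)>(1+\varepsilon(n))\,n$ for all large $n$. Then, as $n\to\infty$, the probability that the implication digraph of $\Phi_{m(n)}(n,2,0)$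 contains a unicycle tends to $1$. Consequently the probability that $\Phi_{m(n)}(n,2,0)$ is unsatisfiable tends to $1$ as well. -/

import Mathlib

open Filter Topology Asymptotics MeasureTheory ProbabilityTheory

namespace PolarizedSAT

/-- A literal on the variables `x_i`, `i : Fin n`: the pair `(i, true)` is the pure literal `x_i`,
the pair `(i, false)` is the negated literal `¬ x_i`. -/
abbrev Literal (n : ℕ) : Type := Fin n × Bool

/-- Negation of a literal. -/
def Literal.neg {n : ℕ} (z : Literal n) : Literal n := (z.1, !z.2)

/-- A clause is identified with the set of literals of which it is the disjunction. -/
abbrev Clause (n : ℕ) : Type := Finset (Literal n)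

/-- A formula in conjunctive normal form with `m` clauses `F 0, …, F (m - 1)`. -/
abbrev Formula (n m : ℕ) : Type := Fin m → Clause n

/-- Some truth assignment makes at least one literal of every clause true. -/
def Formula.Satisfiable {n m : ℕ} (F : Formula n m) : Prop :=
  ∃ σ : Fin n → Bool, ∀ i, ∃ z ∈ F i, σ z.1 = z.2

/-! ### The polarized random model

The sign `+1` is encoded by `true` and the sign `-1` by `false`. -/

/-- The random choices `(K, B, P)` made for one clause: the tuple `K` of variables, the sign `B` of
the clause, and the signs `P_j` of its places. -/
abbrev Seed (n k : ℕ) : Type := (Fin k → Fin n) × Bool × (Fin k → Bool)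

/-- The clause `z_1 ∨ … ∨ z_k`, where `z_j` is the pure literal on the variable `K_j` if
`B P_j = 1`, that is if `B = P_j`, and the negated literal on it otherwise. -/
def Seed.clause {n k : ℕ} (s : Seed n k) : Clause n :=
  Finset.univ.image fun j => (s.1 j, s.2.1 == s.2.2 j)

/-- The law of the choices for one clause: `K` is uniform among the `k`-tuples of distinct indices,
`B` is a fair sign, every `P_j` is `+1` with probability `p` and `-1` with probability `1 - p`, and
all of these are independent. -/
noncomputable def seedLaw (n k : ℕ) (p : unitInterval) : Measure (Seed n k) :=
  (uniformOn {v : Fin k → Fin n | Function.Injective v}).prod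
    ((uniformOn (Set.univ : Set Bool)).prod
      (Measure.pi fun _ : Fin k => bernoulliMeasure true false p))

/-- The law of the choices for `m` independent clauses. -/
noncomputable def modelLaw (n k : ℕ) (p : unitInterval) (m : ℕ) : Measure (Fin m → Seed n k) :=
  Measure.pi fun _ : Fin m => seedLaw n k p

/-- The random formula `Φ_m(n, k, p)`, as a function of the random choices. -/
def randomFormula {n k m : ℕ} (ω : Fin m → Seed n k) : Formula n m :=
  fun i => (ω i).clause

/-- The probability that the `p`-polarized random `k`-CNF formula with `m` clauses on `n` variables
has the property `Q`. -/
noncomputable def prob (n k : ℕ) (p : unitInterval) (m : ℕ) (Q : Formula n m → Prop) : ℝ :=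
  (modelLaw n k p m).real {ω | Q (randomFormula ω)}

/-! ### The digraph of implications -/

/-- The digraph of implications of a 2-CNF formula: its vertices are the `2n` literals, and each
clause `y ∨ z` gives the arcs `¬ y ⇒ z` and `¬ z ⇒ y`. -/
def implicationDigraph {n m : ℕ} (F : Formula n m) : Digraph (Literal n) where
  Adj a b := ∃ i, F i = {a.neg, b}

/-- `c 0 → c 1 → … → c (L - 1) → c 0` is a directed cycle of length `L` in `G`, without repeated
vertices. The permutation `finRotate L` sends `i` to `i + 1` modulo `L`. -/
structure IsDirectedCycle {V : Type*} (G : Digraph V) {L : ℕ} (c : Fin L → V) : Prop where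
  pos : 0 < L
  injective : Function.Injective c
  adj : ∀ i, G.Adj (c i) (c (finRotate L i))

/-- A bicycle: a directed cycle that contains both literals `x`, `¬ x` on some variable. -/
structure IsBicycle {n : ℕ} (G : Digraph (Literal n)) {L : ℕ} (c : Fin L → Literal n) : Prop where
  isDirectedCycle : IsDirectedCycle G c
  exists_conflict : ∃ x : Fin n, (∃ i, c i = (x, true)) ∧ ∃ j, c j = (x, false)

/-- A unicycle: a bicycle of even length with a unique repeated variable `x`, and this variable
occurs precisely twice, as `x` and as `¬ x`, at diametrically opposed points of the cycle. -/
structure IsUnicycle {n : ℕ} (G : Digraph (Literal n)) {L : ℕ} (c : Fin L → Literal n) : Prop where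
  isBicycle : IsBicycle G c
  even_length : Even L
  exists_repeated : ∃ (x : Fin n) (i j : Fin L),
    c i = (x, true) ∧ c j = (x, false) ∧ (i.val + L / 2) % L = j.val ∧
    (∀ a, (c a).1 = x → a = i ∨ a = j) ∧
    ∀ a b, a ≠ b → (c a).1 = (c b).1 → (c a).1 = x

/-- The digraph contains a unicycle. -/
def HasUnicycle {n : ℕ} (G : Digraph (Literal n)) : Prop :=
  ∃ (L : ℕ) (c : Fin L → Literal n), IsUnicycle G c

end PolarizedSAT

/-! Both literals of a fully polarized clause have the same sign, so every walk in the implication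
digraph alternates in sign. A walk with an odd number of steps that returns to its first variable
therefore leads from a literal to its negation. Two such loops of `r + 1` steps each (`r` even)
through a common variable, one starting from each of its literals and otherwise on distinct
variables, make up a unicycle of length `2 * (r + 1)`. The second moment method is applied to these
pairs of loops, counted together with the positions of their clauses in the formula
(`card_mul_le_mul_pi_real`).

Every admissible clause has probability `q = 1 / (n (n - 1))`. Given one occurring pair, the
expected number of occurring pairs is at most the sum over all pairs of a product over steps: a step
contributes `θ = m q`, plus `1` if its clause belongs to the given pair. For a fixed common point
this sum factors into two weighted counts of closed walks, which iterates of a transfer operator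
compute. No classification of the overlaps is needed.

Inside the given pair the alternation of signs leaves a walk one continuation, except at the centre,
where there are two. Walks along shared steps thus grow at most like `ρ ^ j` with `ρ = 1 + 1 / (r +
1)`, whereas free walks grow like `(n θ) ^ j` with `n θ ≥ 1 + ε`. Base points off the given pair
yield asymptotically the first moment; the at most `2 * (r + 1)` base points on it are negligible
once `(1 + ε) ^ (r + 1) ≥ n` (`sum_prod_iterate_transfer_le`). It suffices to take `ε = n ^ (-1/10)`
and `r` of order `n ^ (1/9)`.

Unsatisfiability follows because truth propagates along arcs, hence around a cycle containing `x`
and `¬ x`. -/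

namespace PolarizedSAT

/-! ### The second moment method -/

/-- The second moment inequality for the number of events of a finite family that occur. -/
theorem sq_sum_measureReal_le {Ω ι : Type*} [MeasurableSpace Ω] (μ : Measure Ω)
    [IsProbabilityMeasure μ] [Fintype ι] (B : ι → Set Ω) (hB : ∀ i, MeasurableSet (B i)) :
    (∑ i, μ.real (B i)) ^ 2 ≤ μ.real (⋃ i, B i) * ∑ i, ∑ j, μ.real (B i ∩ B j) := by
  classical
  set U := ⋃ i, B i with hU
  have hUm : MeasurableSet U := MeasurableSet.iUnion hB
  have hint : ∀ s : Set Ω, MeasurableSet s → Integrable (fun ω => s.indicator (1 : Ω → ℝ) ω) μ :=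
    fun s hs => (integrable_const (1 : ℝ)).indicator hs
  -- With `N` the number of events that occur, `1_U - c N` has nonnegative second moment for every
  -- `c`. The claim is the discriminant condition for this quadratic in `c`, using `1_U N = N`.
  have key : ∀ c : ℝ, 0 ≤ (∑ i, ∑ j, μ.real (B i ∩ B j)) * (c * c) +
      (-2 * ∑ i, μ.real (B i)) * c + μ.real U := by
    intro c
    have h1 : 0 ≤ ∫ ω, (U.indicator 1 ω - c * ∑ i, (B i).indicator (1 : Ω → ℝ) ω) ^ 2 ∂μ :=
      integral_nonneg fun _ => sq_nonneg _
    have h2 : ∀ ω, (U.indicator 1 ω - c * ∑ i, (B i).indicator (1 : Ω → ℝ) ω) ^ 2 =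
        (c * c) * (∑ i, ∑ j, (B i ∩ B j).indicator (1 : Ω → ℝ) ω) +
          ((-2 * c) * ∑ i, (B i).indicator (1 : Ω → ℝ) ω + U.indicator 1 ω) := by
      intro ω
      have h3 : U.indicator (1 : Ω → ℝ) ω * ∑ i, (B i).indicator (1 : Ω → ℝ) ω =
          ∑ i, (B i).indicator (1 : Ω → ℝ) ω := by
        rw [Finset.mul_sum]
        refine Finset.sum_congr rfl fun i _ => ?_
        by_cases hi : ω ∈ B i
        · have : ω ∈ U := Set.mem_iUnion.2 ⟨i, hi⟩
          simp [this]
        · simp [hi]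
      have h4 : (∑ i, (B i).indicator (1 : Ω → ℝ) ω) * (∑ i, (B i).indicator (1 : Ω → ℝ) ω) =
          ∑ i, ∑ j, (B i ∩ B j).indicator (1 : Ω → ℝ) ω := by
        rw [Finset.sum_mul_sum]
        refine Finset.sum_congr rfl fun i _ => Finset.sum_congr rfl fun j _ => ?_
        rw [Set.inter_indicator_one]; rfl
      have h5 : U.indicator (1 : Ω → ℝ) ω * U.indicator (1 : Ω → ℝ) ω = U.indicator 1 ω := by
        by_cases hi : ω ∈ U <;> simp [hi]
      rw [← h4]
      linear_combination h5 - 2 * c * h3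
    have i1 : Integrable (fun ω => ∑ i, (B i).indicator (1 : Ω → ℝ) ω) μ :=
      integrable_finsetSum _ fun i _ => hint _ (hB i)
    have i2 : ∀ i, Integrable (fun ω => ∑ j, (B i ∩ B j).indicator (1 : Ω → ℝ) ω) μ := fun i =>
      integrable_finsetSum _ fun j _ => hint _ ((hB i).inter (hB j))
    have i3 : Integrable (fun ω => ∑ i, ∑ j, (B i ∩ B j).indicator (1 : Ω → ℝ) ω) μ :=
      integrable_finsetSum _ fun i _ => i2 i
    simp_rw [h2] at h1
    have i4 : Integrable (fun ω => (-2 * c) * ∑ i, (B i).indicator (1 : Ω → ℝ) ω +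
        U.indicator 1 ω) μ := (i1.const_mul _).add (hint _ hUm)
    rw [integral_add (i3.const_mul _) i4,
      integral_add (i1.const_mul _) (hint _ hUm), integral_const_mul, integral_const_mul,
      integral_finsetSum _ fun i _ => i2 i, integral_finsetSum _ fun i _ => hint _ (hB i),
      integral_indicator_one hUm] at h1
    have h6 : ∀ i, ∫ ω, (B i).indicator (1 : Ω → ℝ) ω ∂μ = μ.real (B i) := fun i =>
      integral_indicator_one (hB i)
    have h7 : ∀ i, ∫ ω, ∑ j, (B i ∩ B j).indicator (1 : Ω → ℝ) ω ∂μ =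
        ∑ j, μ.real (B i ∩ B j) := fun i => by
      rw [integral_finsetSum _ fun j _ => hint _ ((hB i).inter (hB j))]
      exact Finset.sum_congr rfl fun j _ => integral_indicator_one ((hB i).inter (hB j))
    simp_rw [h6, h7] at h1
    linarith
  have := discrim_le_zero key
  rw [discrim] at this
  nlinarith

/-! ### Occurrences of prescribed values among independent samples -/

section Occurrences

variable {S E β : Type*} [MeasurableSpace S] (ν : Measure S) [IsProbabilityMeasure ν] {m : ℕ}
  (cl : S → E) {q : ℝ} [Fintype β]

/-- The probability that prescribed distinct coordinates take prescribed values of equal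
probability. -/
theorem pi_real_forall_eq (φ : β ↪ Fin m) (e : β → E)
    (he : ∀ j, ν.real {s | cl s = e j} = q) :
    (Measure.pi fun _ : Fin m => ν).real {ω | ∀ j, cl (ω (φ j)) = e j} =
      q ^ Fintype.card β := by
  classical
  have h1 : {ω : Fin m → S | ∀ j, cl (ω (φ j)) = e j} =
      Set.pi Set.univ fun a => {s | ∀ j, φ j = a → cl s = e j} := by
    ext ω
    simp only [Set.mem_ofPred_eq, Set.mem_pi, Set.mem_univ, forall_true_left]
    exact ⟨fun h a j hj => hj ▸ h j, fun h j => h _ j rfl⟩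
  rw [h1, measureReal_def, Measure.pi_pi, ENNReal.toReal_prod,
    ← Finset.prod_subset (Finset.subset_univ (Finset.univ.map φ)), Finset.prod_map]
  · have : ∀ j, (ν {s | ∀ i, φ i = φ j → cl s = e i}).toReal = q := fun j => by
      rw [← he j, measureReal_def]
      congr 2
      ext s
      simp
    rw [Finset.prod_congr rfl fun j _ => this j, Finset.prod_const, Finset.card_univ]
  · intro a _ ha
    have : {s | ∀ j, φ j = a → cl s = e j} = Set.univ := by
      ext s
      simp only [Finset.mem_map, Finset.mem_univ, true_and, not_exists] at ha
      simp [ha]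
    simp [this]

open Classical in
/-- Bound for the probability that two families of values occur at prescribed coordinates. -/
theorem pi_real_inter_le (hq : 0 ≤ q) (φ φ' : β ↪ Fin m) (e e' : β → E)
    (he : ∀ j, ν.real {s | cl s = e j} = q) (he' : ∀ j, ν.real {s | cl s = e' j} = q) :
    (Measure.pi fun _ : Fin m => ν).real
        ({ω | ∀ j, cl (ω (φ j)) = e j} ∩ {ω | ∀ j, cl (ω (φ' j)) = e' j}) ≤
      q ^ Fintype.card β * ∏ j, (q + ∑ i, if φ' j = φ i ∧ e' j = e i then 1 else 0) := by
  have hnn : ∀ j, 0 ≤ ∑ i, (if φ' j = φ i ∧ e' j = e i then (1 : ℝ) else 0) := fun j =>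
    Finset.sum_nonneg fun i _ => by split_ifs <;> norm_num
  -- Conflicting prescriptions at a common coordinate make the intersection empty. Otherwise only
  -- the coordinates `φ' j` outside the range of `φ` cost a further factor `q`.
  by_cases hc : ∀ j i, φ' j = φ i → e' j = e i
  · let J : Type _ := {j : β // φ' j ∉ Set.range φ}
    let χ : β ⊕ J ↪ Fin m :=
      ⟨Sum.elim φ fun j => φ' j.1, φ.injective.sumElim
        (φ'.injective.comp Subtype.val_injective) fun i j h => j.2 ⟨i, h⟩⟩
    have h1 := pi_real_forall_eq ν cl (q := q) χ (Sum.elim e fun j : J => e' j.1) (by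
      rintro (j | j)
      · exact he j
      · exact he' j.1)
    calc _ ≤ (Measure.pi fun _ : Fin m => ν).real
          {ω | ∀ j, cl (ω (χ j)) = (Sum.elim e fun j : J => e' j.1) j} := by
          refine measureReal_mono ?_
          rintro ω ⟨h, h'⟩ (j | j)
          · exact h j
          · exact h' j.1
      _ = q ^ Fintype.card β * ∏ j : β, if φ' j ∉ Set.range φ then q else 1 := by
          rw [h1, Fintype.card_sum, pow_add, Finset.prod_ite, Finset.prod_const_one, mul_one,
            Finset.prod_const, Fintype.card_subtype]
      _ ≤ _ := by
          refine mul_le_mul_of_nonneg_left (Finset.prod_le_prod ?_ ?_) (pow_nonneg hq _)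
          · intro j _; split_ifs <;> [norm_num; exact hq]
          · intro j _
            split_ifs with h
            · obtain ⟨i, hi⟩ := h
              have h2 := Finset.single_le_sum
                (f := fun i => if φ' j = φ i ∧ e' j = e i then (1 : ℝ) else 0)
                (fun i _ => by split_ifs <;> norm_num) (Finset.mem_univ i)
              have h3 : φ' j = φ i ∧ e' j = e i := ⟨hi.symm, hc _ _ hi.symm⟩
              rw [if_pos h3] at h2
              linarith
            · linarith [hnn j]
  · push Not at hc
    obtain ⟨j, i, h, h'⟩ := hc
    have : ({ω : Fin m → S | ∀ j, cl (ω (φ j)) = e j} ∩ {ω | ∀ j, cl (ω (φ' j)) = e' j}) = ∅ := by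
      ext ω
      simp only [Set.mem_inter_iff, Set.mem_ofPred_eq, Set.mem_empty_iff_false, iff_false]
      rintro ⟨h1, h2⟩
      exact h' ((h2 j).symm.trans (h ▸ h1 i))
    rw [this, measureReal_empty]
    exact mul_nonneg (pow_nonneg hq _) (Finset.prod_nonneg fun j _ => add_nonneg hq (hnn j))

/-- Lower bound for the probability that one of the tuples `e t` of values occurs. -/
theorem card_mul_le_mul_pi_real [MeasurableSpace E] [DiscreteMeasurableSpace E]
    (hcl : Measurable cl) {τ : Type*} [Fintype τ] (e : τ → β → E)
    (hinj : ∀ t, Function.Injective (e t)) (hq : 0 ≤ q)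
    (he : ∀ t j, ν.real {s | cl s = e t j} = q) (C : ℝ)
    (hC0 : 0 ≤ C)
    (hC : ∀ t, ∑ t', ∏ j, (m * q + (Set.range (e t)).indicator 1 (e t' j)) ≤ C) :
    (Fintype.card τ : ℝ) * m.descFactorial (Fintype.card β) * q ^ Fintype.card β ≤
      (Measure.pi fun _ : Fin m => ν).real
        {ω | ∃ t, ∃ φ : β ↪ Fin m, ∀ j, cl (ω (φ j)) = e t j} * C := by
  classical
  set μ := Measure.pi fun _ : Fin m => ν
  let B : τ × (β ↪ Fin m) → Set (Fin m → S) := fun x => {ω | ∀ j, cl (ω (x.2 j)) = e x.1 j}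
  have hB : ∀ x, MeasurableSet (B x) := fun x => by
    have : B x = ⋂ j, (fun ω : Fin m → S => cl (ω (x.2 j))) ⁻¹' {e x.1 j} := by
      ext ω; simp [B]
    rw [this]
    exact MeasurableSet.iInter fun j =>
      (hcl.comp (measurable_pi_apply _)) (MeasurableSet.of_discrete)
  have h1 : ∑ x, μ.real (B x) =
      (Fintype.card τ : ℝ) * m.descFactorial (Fintype.card β) * q ^ Fintype.card β := by
    rw [Finset.sum_congr rfl fun x _ => pi_real_forall_eq ν cl x.2 (e x.1) (he x.1)]
    simp [Fintype.card_embedding_eq]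
  have h2 : ∀ x, ∑ y, μ.real (B x ∩ B y) ≤ q ^ Fintype.card β * C := by
    rintro ⟨t, φ⟩
    rw [Fintype.sum_prod_type]
    calc _ ≤ ∑ t', ∑ φ' : β ↪ Fin m, q ^ Fintype.card β *
          ∏ j, (q + ∑ i, if φ' j = φ i ∧ e t' j = e t i then 1 else 0) :=
          Finset.sum_le_sum fun t' _ => Finset.sum_le_sum fun φ' _ =>
            pi_real_inter_le ν cl hq φ φ' (e t) (e t') (he t) (he t')
      _ ≤ ∑ t', q ^ Fintype.card β *
          ∏ j, (m * q + (Set.range (e t)).indicator 1 (e t' j)) := by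
          refine Finset.sum_le_sum fun t' _ => ?_
          rw [← Finset.mul_sum]
          refine mul_le_mul_of_nonneg_left ?_ (pow_nonneg hq _)
          let g : β → Fin m → ℝ := fun j a =>
            q + ∑ i, if a = φ i ∧ e t' j = e t i then 1 else 0
          have hg : ∀ j a, 0 ≤ g j a := fun j a => add_nonneg hq
            (Finset.sum_nonneg fun i _ => by split_ifs <;> norm_num)
          -- Dropping injectivity of `φ'` only adds nonnegative terms, and the sum then factors into
          -- one sum over coordinates for each `j`.
          have h3 : ∑ φ' : β ↪ Fin m, ∏ j, g j (φ' j) ≤ ∑ f : β → Fin m, ∏ j, g j (f j) := by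
            have := Finset.sum_map (Finset.univ : Finset (β ↪ Fin m))
              ⟨fun φ' : β ↪ Fin m => (φ' : β → Fin m), DFunLike.coe_injective⟩
              (fun f => ∏ j, g j (f j))
            simp only [Function.Embedding.coeFn_mk] at this
            rw [← this]
            exact Finset.sum_le_sum_of_subset_of_nonneg (Finset.subset_univ _)
              fun f _ _ => Finset.prod_nonneg fun j _ => hg j _
          refine h3.trans ?_
          rw [← Fintype.piFinset_univ, ← Finset.prod_univ_sum]
          refine Finset.prod_le_prod (fun j _ => Finset.sum_nonneg fun a _ => hg j a)
            fun j _ => ?_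
          simp only [g]
          rw [Finset.sum_add_distrib, Finset.sum_comm]
          have h4 : ∀ i, ∑ a, (if a = φ i ∧ e t' j = e t i then (1 : ℝ) else 0) =
              if e t' j = e t i then 1 else 0 := fun i => by
            by_cases h : e t' j = e t i <;> simp [h]
          simp only [h4, Finset.sum_const, Finset.card_univ, Fintype.card_fin, nsmul_eq_mul]
          gcongr
          rw [Set.indicator_apply, Pi.one_apply]
          split_ifs with h
          · obtain ⟨i, hi⟩ := h
            have h5 : ∀ i', (e t' j = e t i') ↔ i = i' := fun i' => by
              rw [← hi]; exact (hinj t).eq_iff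
            simp [h5]
          · exact (Finset.sum_eq_zero fun i _ => if_neg fun h' => h ⟨i, h'.symm⟩).le
      _ ≤ _ := by
          rw [← Finset.mul_sum]
          exact mul_le_mul_of_nonneg_left (hC t) (pow_nonneg hq _)
  have h3 := sq_sum_measureReal_le μ B hB
  have h4 : ∑ x, ∑ y, μ.real (B x ∩ B y) ≤ (∑ x, μ.real (B x)) * C := by
    refine (Finset.sum_le_sum fun x _ => h2 x).trans_eq ?_
    rw [h1]
    simp [Fintype.card_embedding_eq]
    ring
  have h5 : (⋃ x, B x) = {ω | ∃ t, ∃ φ : β ↪ Fin m, ∀ j, cl (ω (φ j)) = e t j} := by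
    ext ω; simp [B]
  rw [h5] at h3
  rw [← h1]
  have hs : 0 ≤ ∑ x, μ.real (B x) := Finset.sum_nonneg fun _ _ => measureReal_nonneg
  rcases hs.eq_or_lt with h0 | h0
  · rw [← h0]; positivity
  · have h6 := h3.trans (mul_le_mul_of_nonneg_left h4 measureReal_nonneg)
    have : (∑ x, μ.real (B x)) * (∑ x, μ.real (B x)) ≤ (∑ x, μ.real (B x)) *
      (μ.real {ω | ∃ t, ∃ φ : β ↪ Fin m, ∀ j, cl (ω (φ j)) = e t j} * C) := by nlinarith
    exact le_of_mul_le_mul_left this h0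

end Occurrences

/-! ### Weighted walks with alternating signs -/

/-- The sign after `p` steps of a walk with alternating signs that starts with the sign `s`. -/
def alternate (s : Bool) (p : ℕ) : Bool := xor s p.bodd

theorem alternate_zero (s : Bool) : alternate s 0 = s := by simp [alternate]

theorem alternate_succ (s : Bool) (p : ℕ) : alternate s (p + 1) = !alternate s p := by
  simp [alternate]

theorem alternate_not (s : Bool) (p : ℕ) : alternate (!s) p = alternate s (p + 1) := by
  simp [alternate]

theorem alternate_of_even (s : Bool) {p : ℕ} (hp : Even p) : alternate s p = s := by
  obtain ⟨j, rfl⟩ := hp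
  simp [alternate]

theorem alternate_of_odd (s : Bool) {p : ℕ} (hp : Odd p) : alternate s p = !s := by
  obtain ⟨j, rfl⟩ := hp
  rw [alternate_succ, alternate_of_even s (even_two_mul j)]

/-- The sequence `a, y 0, …, y (r - 1), b, b, …`. -/
def path {α : Type*} {r : ℕ} (a : α) (y : Fin r → α) (b : α) : ℕ → α
  | 0 => a
  | p + 1 => if h : p < r then y ⟨p, h⟩ else b

theorem path_cons_succ {α : Type*} {r : ℕ} (a v : α) (y : Fin r → α) (b : α) (p : ℕ) :
    path a (Fin.cons v y : Fin (r + 1) → α) b (p + 1) = path v y b p := by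
  cases p with
  | zero => simp [path]
  | succ p =>
    simp only [path, Nat.add_lt_add_iff_right]
    split_ifs with h
    · exact Fin.cons_succ (α := fun _ => α) v y ⟨p, h⟩
    · rfl

theorem map_path {α γ : Type*} {r : ℕ} (f : α → γ) (a : α) (y : Fin r → α) (b : α) (p : ℕ) :
    f (path a y b p) = path (f a) (fun i => f (y i)) (f b) p := by
  cases p with
  | zero => rfl
  | succ p => simp only [path]; split_ifs <;> rfl

section Walks

variable {α : Type*} [Fintype α]

/-- The transfer operator of the weights `w`, where `w s u v` is the weight of a step from `u` to
`v` that ends with the sign `s`. -/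
def transfer (w : Bool → α → α → ℝ) (f : α → Bool → ℝ) : α → Bool → ℝ :=
  fun u s => ∑ v, w (!s) u v * f v (!s)

/-- The total weight of the walks of given length between two points. -/
theorem sum_prod_path [DecidableEq α] (w : Bool → α → α → ℝ) (b : α) (r : ℕ) (a : α) (s : Bool) :
    ∑ y : Fin r → α, ∏ p ∈ Finset.range (r + 1),
      w (alternate s (p + 1)) (path a y b p) (path a y b (p + 1)) =
      (transfer w)^[r + 1] (fun u _ => if u = b then 1 else 0) a s := by
  induction r generalizing a s with
  | zero => simp [transfer, path, alternate]
  | succ r ih =>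
    rw [Function.iterate_succ_apply', transfer]
    rw [← (Fin.consEquiv fun _ : Fin (r + 1) => α).sum_comp, Fintype.sum_prod_type]
    refine Finset.sum_congr rfl fun v _ => ?_
    rw [← ih, Finset.mul_sum]
    refine Finset.sum_congr rfl fun y _ => ?_
    rw [Finset.prod_range_succ', mul_comm]
    congr 1
    · simp [Fin.consEquiv, path, alternate]
    · refine Finset.prod_congr rfl fun p _ => ?_
      simp only [Fin.consEquiv, Equiv.coe_fn_mk, path_cons_succ, alternate_not]

theorem transfer_mono {w : Bool → α → α → ℝ} (hw : ∀ s u v, 0 ≤ w s u v) {f g : α → Bool → ℝ}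
    (h : ∀ u s, f u s ≤ g u s) (u : α) (s : Bool) : transfer w f u s ≤ transfer w g u s :=
  Finset.sum_le_sum fun v _ => mul_le_mul_of_nonneg_left (h v _) (hw _ _ _)

theorem transfer_const_mul (w : Bool → α → α → ℝ) (c : ℝ) (f : α → Bool → ℝ) :
    transfer w (fun u s => c * f u s) = fun u s => c * transfer w f u s := by
  funext u s
  rw [transfer, transfer, Finset.mul_sum]
  exact Finset.sum_congr rfl fun v _ => by ring

theorem transfer_add (w : Bool → α → α → ℝ) (f g : α → Bool → ℝ) :
    transfer w (fun u s => f u s + g u s) = fun u s => transfer w f u s + transfer w g u s := by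
  funext u s
  simp only [transfer]
  rw [← Finset.sum_add_distrib]
  exact Finset.sum_congr rfl fun v _ => by ring

/-- Upper bounds for the number of walks, from a weight function `ψ` that the transfer operator of
the exceptional steps increases at most by the factor `ρ`. -/
structure IsGrowthWeight (A : Bool → α → α → ℝ) (ψ : α → Bool → ℝ) (ρ Ψ : ℝ) : Prop where
  nonneg : ∀ u s, 0 ≤ ψ u s
  transfer_le : ∀ u s, transfer A ψ u s ≤ ρ * ψ u s
  degree_le : ∀ u s, ∑ v, A (!s) u v ≤ 2 * ψ u s
  sum_le : ∀ s, ∑ u, ψ u s ≤ Ψ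

variable {A : Bool → α → α → ℝ} {ψ : α → Bool → ℝ} {ρ Ψ θ K : ℝ}

theorem transfer_const_add (f : α → Bool → ℝ) (u : α) (s : Bool) :
    transfer (fun s u v => θ + A s u v) f u s = θ * ∑ v, f v (!s) + transfer A f u s := by
  simp only [transfer, Finset.mul_sum]
  rw [← Finset.sum_add_distrib]
  exact Finset.sum_congr rfl fun v _ => by ring

/-- The constant `1` absorbs the free steps. The exceptional steps contribute at most `(2 + K * ρ) *
ψ`, and `hKρ` says exactly that this is at most `K * (card α * θ) * ψ`. So `1 + K * ψ` is almost an
eigenfunction for the free growth rate. -/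
theorem IsGrowthWeight.transfer_one_add_le (h : IsGrowthWeight A ψ ρ Ψ) (hθ : 0 ≤ θ) (hK : 0 ≤ K)
    (hKρ : 2 ≤ K * (Fintype.card α * θ - ρ)) (u : α) (s : Bool) :
    transfer (fun s u v => θ + A s u v) (fun u s => 1 + K * ψ u s) u s ≤
      (Fintype.card α * θ + θ * (K * Ψ)) * (1 + K * ψ u s) := by
  rw [transfer_const_add, transfer_add A (fun _ _ => 1) fun u s => K * ψ u s, transfer_const_mul,
    Finset.sum_add_distrib, ← Finset.mul_sum]
  have h1 : transfer A (fun _ _ => (1 : ℝ)) u s ≤ 2 * ψ u s := by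
    simpa [transfer] using h.degree_le u s
  have h2 := mul_le_mul_of_nonneg_left (h.transfer_le u s) hK
  have h3 := mul_le_mul_of_nonneg_left (mul_le_mul_of_nonneg_left (h.sum_le (!s)) hK) hθ
  have h4 := mul_le_mul_of_nonneg_right hKρ (h.nonneg u s)
  have h5 : 0 ≤ Ψ := (Finset.sum_nonneg fun u _ => h.nonneg u s).trans (h.sum_le s)
  have h6 : 0 ≤ θ * (K * Ψ) * (K * ψ u s) := by have := h.nonneg u s; positivity
  simp only [Finset.sum_const, Finset.card_univ, nsmul_eq_mul, mul_one]
  nlinarith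

theorem iterate_transfer_le {w : Bool → α → α → ℝ} (hw : ∀ s u v, 0 ≤ w s u v)
    {f g : α → Bool → ℝ} {c γ : ℝ} (hc : 0 ≤ c) (hγ : 0 ≤ γ) (hf : ∀ u s, f u s ≤ c * g u s)
    (hg : ∀ u s, transfer w g u s ≤ γ * g u s) (j : ℕ) (u : α) (s : Bool) :
    (transfer w)^[j] f u s ≤ c * γ ^ j * g u s := by
  induction j generalizing u s with
  | zero => simpa using hf u s
  | succ j ih =>
    rw [Function.iterate_succ_apply']
    refine (transfer_mono hw ih u s).trans ?_
    rw [transfer_const_mul w (c * γ ^ j) g]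
    refine (mul_le_mul_of_nonneg_left (hg u s) (by positivity)).trans_eq (by ring)

/-- Walks to a point that is not the end of an exceptional step. -/
theorem IsGrowthWeight.iterate_le_of_forall_eq_zero [DecidableEq α] (h : IsGrowthWeight A ψ ρ Ψ)
    (hA : ∀ s u v, 0 ≤ A s u v) (hθ : 0 ≤ θ) (hK : 0 ≤ K)
    (hKρ : 2 ≤ K * (Fintype.card α * θ - ρ)) (b : α) (hb : ∀ s u, A s u b = 0) (r : ℕ) (u : α)
    (s : Bool) :
    (transfer fun s u v => θ + A s u v)^[r + 1] (fun u _ => if u = b then 1 else 0) u s ≤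
      θ * (Fintype.card α * θ + θ * (K * Ψ)) ^ r * (1 + K * ψ u s) := by
  have h5 : 0 ≤ Ψ := (Finset.sum_nonneg fun u _ => h.nonneg u s).trans (h.sum_le s)
  -- The last step, into `b`, must be free: it yields the factor `θ` and a constant function, to
  -- which the growth bound applies.
  rw [Function.iterate_succ_apply]
  refine iterate_transfer_le (g := fun u s => 1 + K * ψ u s)
    (fun s u v => add_nonneg hθ (hA s u v)) hθ (by positivity) ?_
    (h.transfer_one_add_le hθ hK hKρ) r u s
  intro u s
  have : transfer (fun s u v => θ + A s u v) (fun u _ => if u = b then 1 else 0) u s = θ := by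
    simp [transfer, hb]
  rw [this]
  have := h.nonneg u s
  nlinarith [mul_nonneg hθ (mul_nonneg hK this)]

/-- Walks to a point of weight at least `1`. -/
theorem IsGrowthWeight.iterate_le [DecidableEq α] (h : IsGrowthWeight A ψ ρ Ψ)
    (hA : ∀ s u v, 0 ≤ A s u v) (hθ : 0 ≤ θ) (hK : 0 ≤ K) (hρ : 0 ≤ ρ)
    (hρθ : ρ ≤ Fintype.card α * θ)
    (hKρ : 2 ≤ K * (Fintype.card α * θ - ρ)) (b : α) (hb : ∀ s, 1 ≤ ψ b s) (j : ℕ) (u : α)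
    (s : Bool) :
    (transfer fun s u v => θ + A s u v)^[j] (fun u _ => if u = b then 1 else 0) u s ≤
      ρ ^ j * ψ u s +
        j * (θ * Ψ) * (Fintype.card α * θ + θ * (K * Ψ)) ^ (j - 1) * (1 + K * ψ u s) := by
  have h5 : 0 ≤ Ψ := (Finset.sum_nonneg fun u _ => h.nonneg u s).trans (h.sum_le s)
  set γ := Fintype.card α * θ + θ * (K * Ψ) with hγ
  have hγ0 : 0 ≤ γ := by positivity
  have hργ : ρ ≤ γ := hρθ.trans (by rw [hγ]; linarith [mul_nonneg hθ (mul_nonneg hK h5)])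
  have hw : ∀ s u v, 0 ≤ θ + A s u v := fun s u v => add_nonneg hθ (hA s u v)
  -- Walks are split by their last free step. Without one they weigh at most `ρ ^ j * ψ`. Otherwise
  -- that step contributes `θ * Ψ`, it has `j` possible positions, and every other step costs at
  -- most `γ`.
  induction j generalizing u s with
  | zero =>
    have := h.nonneg u s
    by_cases hu : u = b
    · subst hu; simpa using hb s
    · simpa [hu] using this
  | succ j ih =>
    rw [Function.iterate_succ_apply']
    refine (transfer_mono hw ih u s).trans ?_
    rw [transfer_add _ (fun u s => ρ ^ j * ψ u s), transfer_const_mul, transfer_const_mul]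
    have h1 := h.transfer_one_add_le hθ hK hKρ u s
    have h2 : transfer (fun s u v => θ + A s u v) ψ u s ≤ θ * Ψ + ρ * ψ u s := by
      rw [transfer_const_add]
      exact add_le_add (mul_le_mul_of_nonneg_left (h.sum_le _) hθ) (h.transfer_le u s)
    have h3 := mul_le_mul_of_nonneg_left h2 (pow_nonneg hρ j)
    have h4 := mul_le_mul_of_nonneg_left h1
      (show 0 ≤ j * (θ * Ψ) * γ ^ (j - 1) by positivity)
    have h6 : ρ ^ j * (θ * Ψ) ≤ γ ^ j * (θ * Ψ) * (1 + K * ψ u s) := by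
      have h7 : ρ ^ j * (θ * Ψ) ≤ γ ^ j * (θ * Ψ) :=
        mul_le_mul_of_nonneg_right (pow_le_pow_left₀ hρ hργ j) (by positivity)
      have h8 := h.nonneg u s
      have : 0 ≤ γ ^ j * (θ * Ψ) * (K * ψ u s) := by positivity
      linarith
    -- For `j = 0` the exponent is truncated, which is harmless because the coefficient `j`
    -- vanishes.
    have h9 : (j : ℝ) * (θ * Ψ) * γ ^ (j - 1) * (γ * (1 + K * ψ u s)) =
        j * (θ * Ψ) * γ ^ j * (1 + K * ψ u s) := by
      cases j with
      | zero => simp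
      | succ j => rw [Nat.add_sub_cancel]; ring
    rw [h9] at h4
    push_cast
    refine (add_le_add h3 h4).trans ?_
    rw [pow_succ]
    linarith

end Walks

/-! ### Pairs of loops through a common point -/

section Loops

variable {r : ℕ}

/-- The `p`-th point of the loop `l` of a pair of loops with `r + 1` steps each: the point `none` is
common to the two loops. -/
def place (l : Bool) : ℕ → Option (Bool × Fin r) := path none (fun i => some (l, i)) none

theorem place_zero (l : Bool) : place (r := r) l 0 = none := rfl

theorem place_succ (l : Bool) {p : ℕ} (hp : p < r) : place l (p + 1) = some (l, ⟨p, hp⟩) := by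
  simp [place, path, hp]

theorem place_last (l : Bool) : place (r := r) l (r + 1) = none := by simp [place, path]

theorem eq_of_place_eq_some {l l' : Bool} {p : ℕ} {i : Fin r} (h : place l p = some (l', i)) :
    l = l' ∧ p = i + 1 := by
  cases p with
  | zero => simp [place, path] at h
  | succ p =>
    by_cases hp : p < r
    · rw [place_succ l hp] at h
      simp only [Option.some.injEq, Prod.mk.injEq] at h
      exact ⟨h.1, by rw [← h.2]⟩
    · simp [place, path, hp] at h

theorem eq_zero_of_place_eq_none {l : Bool} {p : ℕ} (hp : p ≤ r)
    (h : place (r := r) l p = none) : p = 0 := by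
  cases p with
  | zero => rfl
  | succ p => rw [place_succ l (by omega)] at h; simp at h

theorem place_injOn {l l' : Bool} {p p' : ℕ} (hp' : p' ≤ r) (h0 : p' ≠ 0)
    (h : place (r := r) l p = place l' p') : l = l' ∧ p = p' := by
  obtain ⟨p', rfl⟩ := Nat.exists_eq_succ_of_ne_zero h0
  rw [Nat.succ_eq_add_one, place_succ l' hp'] at h
  exact eq_of_place_eq_some h

variable {n : ℕ}

theorem eq_of_pair_eq_pair {a b c d : Fin n} {s t : Bool}
    (h : ({(a, s), (b, s)} : Clause n) = {(c, t), (d, t)}) :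
    s = t ∧ (a = c ∧ b = d ∨ a = d ∧ b = c) := by
  have h' := congrArg (fun x : Clause n => (x : Set (Literal n))) h
  simp only [Finset.coe_insert, Finset.coe_singleton, Set.pair_eq_pair_iff, Prod.mk.injEq] at h'
  tauto

/-- The literal at the `p`-th point of the loop `l`. -/
def loopLiteral (v : Option (Bool × Fin r) → Fin n) (l : Bool) (p : ℕ) : Literal n :=
  (v (place l p), alternate l p)

/-- The clause of the `p`-th step of a loop. -/
def loopClause (v : Option (Bool × Fin r) → Fin n) (j : Bool × Fin (r + 1)) : Clause n :=
  {(v (place j.1 j.2), alternate j.1 (j.2 + 1)), (v (place j.1 (j.2 + 1)), alternate j.1 (j.2 + 1))}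

theorem loopClause_eq (v : Option (Bool × Fin r) → Fin n) (l : Bool) (p : Fin (r + 1)) :
    loopClause v (l, p) = {(loopLiteral v l p).neg, loopLiteral v l (p + 1)} := by
  simp [loopClause, loopLiteral, Literal.neg, alternate_succ]

/-- The odd number `r + 1` of steps flips the sign, so each loop ends where the other begins. This
closes the cycle and puts the two central literals at opposite points. -/
theorem loopLiteral_last (hr : Even r) (v : Option (Bool × Fin r) → Fin n) (l : Bool) :
    loopLiteral v l (r + 1) = loopLiteral v (!l) 0 := by
  rw [loopLiteral, loopLiteral, place_last, place_zero, alternate_of_odd l hr.add_one,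
    alternate_zero]

theorem place_ne_place_succ (hr : 2 ≤ r) (l : Bool) (p : Fin (r + 1)) :
    place (r := r) l p ≠ place l (p + 1) := by
  intro h
  have hp : (p : ℕ) ≤ r := by omega
  rcases Nat.eq_zero_or_pos (p : ℕ) with h0 | h0
  · rw [h0] at h
    have := (place_injOn (by omega) (by omega) h).2
    omega
  · have := (place_injOn hp (by omega) h.symm).2
    omega

/-- A step is recovered from its unordered pair of places. With a single inner point the first and
last steps of a loop would join the same two places, hence `2 ≤ r`. -/
theorem loopClause_injective (hr : 2 ≤ r) (v : Option (Bool × Fin r) ↪ Fin n) :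
    Function.Injective (loopClause v) := by
  rintro ⟨l, p⟩ ⟨l', p'⟩ h
  obtain ⟨hs, h⟩ := eq_of_pair_eq_pair h
  simp only [v.injective.eq_iff] at h
  have hp : (p : ℕ) ≤ r := by omega
  have hp' : (p' : ℕ) ≤ r := by omega
  rcases h with ⟨h1, h2⟩ | ⟨h1, h2⟩
  · rcases Nat.eq_zero_or_pos (p' : ℕ) with h0 | h0
    · rw [h0] at h1 h2
      have := eq_zero_of_place_eq_none hp h1
      rw [this] at h2
      have h3 := (place_injOn (by omega) (by omega) h2).1
      exact Prod.ext h3 (Fin.ext (by simp only; omega))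
    · obtain ⟨h3, h4⟩ := place_injOn hp' (by omega) h1
      exact Prod.ext h3 (Fin.ext h4)
  · exfalso
    rcases Nat.eq_zero_or_pos (p' : ℕ) with h0 | h0
    · rw [h0] at h1 h2
      have h3 := (place_injOn (by omega) (by omega) h1).2
      rw [h3] at h2
      rcases Nat.lt_or_ge r 2 with h4 | h4
      · omega
      · have := eq_zero_of_place_eq_none (by omega) h2
        omega
    · have h3 := (place_injOn hp' (by omega) h2).2
      rcases Nat.lt_or_ge (p' : ℕ) r with h4 | h4
      · have := (place_injOn (by omega) (by omega) h1).2
        omega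
      · have h5 : (p' : ℕ) = r := by omega
        rw [h5, place_last] at h1
        have := eq_zero_of_place_eq_none hp h1
        omega

theorem hasUnicycle_of_loopClause (hr : Even r) {m : ℕ} (F : Formula n m)
    (v : Option (Bool × Fin r) ↪ Fin n) (h : ∀ j, ∃ i, F i = loopClause v j) :
    HasUnicycle (implicationDigraph F) := by
  have hadj : ∀ (l : Bool) (p : ℕ), p ≤ r →
      (implicationDigraph F).Adj (loopLiteral v l p) (loopLiteral v l (p + 1)) := fun l p hp => by
    obtain ⟨i, hi⟩ := h (l, ⟨p, by omega⟩)
    exact ⟨i, hi.trans (loopClause_eq v l ⟨p, by omega⟩)⟩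
  -- Loop `true` followed by loop `false`, each without its endpoint; only positions `0` and `r + 1`
  -- share a variable.
  let c : Fin (2 * r + 1 + 1) → Literal n := fun i =>
    if (i : ℕ) ≤ r then loopLiteral v true i else loopLiteral v false (i - (r + 1))
  have hplace : ∀ {l l' : Bool} {p p' : ℕ}, p ≤ r → p' ≤ r →
      (loopLiteral v l p).1 = (loopLiteral v l' p').1 → (l = l' ∧ p = p') ∨ (p = 0 ∧ p' = 0) := by
    intro l l' p p' hp hp' hv
    have hv := v.injective hv
    by_cases h0 : p' = 0
    · rw [h0] at hv
      exact Or.inr ⟨eq_zero_of_place_eq_none hp hv, h0⟩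
    · exact Or.inl (place_injOn hp' h0 hv)
  have hc : ∀ a b, (c a).1 = (c b).1 →
      a = b ∨ ((a : ℕ) = 0 ∨ (a : ℕ) = r + 1) ∧ ((b : ℕ) = 0 ∨ (b : ℕ) = r + 1) := by
    intro a b hab
    simp only [c] at hab
    split_ifs at hab with h1 h2 h2
    · rcases hplace h1 h2 hab with ⟨_, h3⟩ | h3
      · exact Or.inl (Fin.ext h3)
      · right; omega
    · rcases hplace h1 (by omega) hab with ⟨h3, _⟩ | h3
      · simp at h3
      · right; omega
    · rcases hplace (by omega) h2 hab with ⟨h3, _⟩ | h3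
      · simp at h3
      · right; omega
    · rcases hplace (by omega) (by omega) hab with ⟨_, h3⟩ | h3
      · exact Or.inl (Fin.ext (by omega))
      · right; omega
  have hc0 : c 0 = (v none, true) := by simp [c, loopLiteral, place_zero, alternate_zero]
  let o : Fin (2 * r + 1 + 1) := ⟨r + 1, by omega⟩
  have hc1 : c o = (v none, false) := by
    simp [c, o, loopLiteral, place_zero, alternate_zero]
  have hcinj : Function.Injective c := by
    intro a b hab
    rcases hc a b (congrArg Prod.fst hab) with h1 | ⟨h1, h2⟩
    · exact h1
    · have h3 : ∀ a : Fin (2 * r + 1 + 1), ((a : ℕ) = 0 ∨ (a : ℕ) = r + 1) → a = 0 ∨ a = o :=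
        fun a ha => ha.imp (fun h => Fin.ext h) (fun h => Fin.ext h)
      rcases h3 a h1 with rfl | rfl <;> rcases h3 b h2 with rfl | rfl
      · rfl
      · rw [hc0, hc1] at hab; simp at hab
      · rw [hc0, hc1] at hab; simp at hab
      · rfl
  refine ⟨_, c, ⟨⟨⟨by omega, hcinj, ?_⟩, ⟨v none, ⟨0, hc0⟩, ⟨o, hc1⟩⟩⟩, ⟨r + 1, by ring⟩,
    ⟨v none, 0, o, hc0, hc1, ?_, ?_, ?_⟩⟩⟩
  · intro i
    by_cases hi : i = Fin.last (2 * r + 1)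
    · rw [hi, finRotate_last, hc0]
      have h1 := hadj false r le_rfl
      rw [loopLiteral_last hr] at h1
      have h2 : c (Fin.last (2 * r + 1)) = loopLiteral v false r := by
        simp only [c, Fin.val_last]
        rw [if_neg (by omega)]
        congr 1
        omega
      rw [h2]
      simpa [loopLiteral, place_zero, alternate_zero] using h1
    · have h1 := coe_finRotate_of_ne_last hi
      have h2 : (i : ℕ) < 2 * r + 1 := Fin.val_lt_last hi
      simp only [c, h1]
      rcases lt_trichotomy (i : ℕ) r with h3 | h3 | h3
      · rw [if_pos h3.le, if_pos (by omega)]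
        exact hadj true i h3.le
      · rw [if_pos h3.le, if_neg (by omega), h3, Nat.sub_self]
        have h1 := hadj true r le_rfl
        rwa [loopLiteral_last hr] at h1
      · rw [if_neg (by omega), if_neg (by omega), Nat.sub_add_comm (by omega)]
        exact hadj false _ (by omega)
  · simp only [Fin.val_zero, o]
    rw [Nat.mod_eq_of_lt] <;> omega
  · intro a ha
    have := hc a 0 (by rw [ha, hc0])
    rcases this with h1 | ⟨h1, -⟩
    · exact Or.inl h1
    · exact h1.imp (fun h => Fin.ext h) (fun h => Fin.ext h)
  · intro a b hab h1
    rcases hc a b h1 with h2 | ⟨h2, -⟩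
    · exact absurd h2 hab
    · rcases h2 with h2 | h2
      · rw [show a = 0 from Fin.ext h2, hc0]
      · rw [show a = o from Fin.ext h2, hc1]

/-- A satisfying assignment carries truth along every arc, so all literals of a cycle have the same
truth value, which is impossible for `x` and `¬ x`. -/
theorem not_satisfiable_of_hasUnicycle {m : ℕ} (F : Formula n m)
    (h : HasUnicycle (implicationDigraph F)) : ¬ F.Satisfiable := by
  rintro ⟨σ, hσ⟩
  obtain ⟨L, c, hc⟩ := h
  obtain ⟨x, ⟨i, hi⟩, j, hj⟩ := hc.isBicycle.exists_conflict
  have hpos := hc.isBicycle.isDirectedCycle.pos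
  have hstep : ∀ i, σ (c i).1 = (c i).2 → σ (c (finRotate L i)).1 = (c (finRotate L i)).2 := by
    intro i h
    obtain ⟨k, hk⟩ := hc.isBicycle.isDirectedCycle.adj i
    obtain ⟨z, hz, hz'⟩ := hσ k
    rw [hk, Finset.mem_insert, Finset.mem_singleton] at hz
    rcases hz with rfl | rfl
    · simp only [Literal.neg] at hz'
      rw [h] at hz'
      simp at hz'
    · exact hz'
  obtain ⟨L, rfl⟩ := Nat.exists_eq_succ_of_ne_zero hpos.ne'
  have hall : ∀ (k : ℕ) (i : Fin (L + 1)), σ (c i).1 = (c i).2 →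
      σ (c (i + Fin.ofNat (L + 1) k)).1 = (c (i + Fin.ofNat (L + 1) k)).2 := by
    intro k i h
    induction k with
    | zero => simpa using h
    | succ k ih =>
      have h1 : Fin.ofNat (L + 1) (k + 1) = Fin.ofNat (L + 1) k + 1 := by
        ext; simp [Fin.val_add]
      have := hstep _ ih
      rw [finRotate_apply] at this
      rw [h1, ← add_assoc]
      exact this
  have hto : ∀ i j : Fin (L + 1), σ (c i).1 = (c i).2 → σ (c j).1 = (c j).2 := by
    intro i j h
    have := hall (j - i : Fin (L + 1)).val i h
    rwa [Fin.ofNat_val_eq_self, add_sub_cancel] at this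
  have h1 := hto i j
  have h2 := hto j i
  rw [hi, hj] at h1 h2
  simp only at h1 h2
  cases hx : σ x <;> simp [hx] at h1 h2

end Loops

/-! ### Growth of walks along the steps of a given pair of loops -/

section Growth

theorem sum_ite_mul_le_of_eq {α : Type*} [Fintype α] (P : α → Prop) [DecidablePred P] (f : α → ℝ)
    (hf : ∀ x, 0 ≤ f x) (a : α) (h : ∀ x, P x → x = a) :
    ∑ x, (if P x then 1 else 0) * f x ≤ f a := by
  classical
  calc _ ≤ ∑ x, if x = a then f x else 0 := by
        refine Finset.sum_le_sum fun x _ => ?_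
        have := hf x
        have := h x
        split_ifs <;> simp_all
    _ = f a := by simp

theorem sum_ite_mul_le_of_eq_or_eq {α : Type*} [Fintype α] (P : α → Prop) [DecidablePred P]
    (f : α → ℝ) (hf : ∀ x, 0 ≤ f x) (a b : α) (h : ∀ x, P x → x = a ∨ x = b) :
    ∑ x, (if P x then 1 else 0) * f x ≤ f a + f b := by
  classical
  calc _ ≤ ∑ x, ((if x = a then f x else 0) + if x = b then f x else 0) := by
        refine Finset.sum_le_sum fun x _ => ?_
        have h1 := hf x
        by_cases hP : P x
        · rcases h x hP with rfl | rfl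
          · simp only [hP, if_true, one_mul]
            split_ifs <;> linarith
          · simp only [hP, if_true, one_mul]
            split_ifs <;> linarith
        · simp only [hP, if_false, zero_mul]
          split_ifs <;> linarith
    _ = f a + f b := by rw [Finset.sum_add_distrib]; simp

variable {r n : ℕ}

/-- The indicator of the clauses of a pair of loops. -/
noncomputable def loopStep (v : Option (Bool × Fin r) → Fin n) (s : Bool) (a b : Fin n) : ℝ :=
  (Set.range (loopClause v)).indicator 1 {(a, s), (b, s)}

open Classical in
theorem loopStep_eq (v : Option (Bool × Fin r) → Fin n) (s : Bool) (a b : Fin n) :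
    loopStep v s a b =
      if ({(a, s), (b, s)} : Clause n) ∈ Set.range (loopClause v) then 1 else 0 := by
  rw [loopStep, Set.indicator_apply, Pi.one_apply]

theorem loopStep_nonneg (v : Option (Bool × Fin r) → Fin n) (s : Bool) (a b : Fin n) :
    0 ≤ loopStep v s a b :=
  Set.indicator_nonneg (fun _ _ => zero_le_one) _

theorem exists_of_mem_range_loopClause {v : Option (Bool × Fin r) → Fin n} {s : Bool}
    {a b : Fin n} (h : ({(a, s), (b, s)} : Clause n) ∈ Set.range (loopClause v)) :
    ∃ l, ∃ p ≤ r, s = alternate l (p + 1) ∧ (a = v (place l p) ∧ b = v (place l (p + 1)) ∨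
      a = v (place l (p + 1)) ∧ b = v (place l p)) := by
  obtain ⟨⟨l, p⟩, h⟩ := h
  obtain ⟨h1, h2⟩ := eq_of_pair_eq_pair h
  refine ⟨l, p, by omega, h1.symm, ?_⟩
  rcases h2 with ⟨h2, h3⟩ | ⟨h2, h3⟩
  · exact Or.inl ⟨h2.symm, h3.symm⟩
  · exact Or.inr ⟨h3.symm, h2.symm⟩

/-- The growth weight of a pair of loops. -/
def loopWeight (ρ : ℝ) : Option (Bool × Fin r) → Bool → ℝ
  | none, _ => 2
  -- The sign fixes the direction of travel, and the exponent is the number of steps made since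
  -- leaving the centre in that direction. The central weight `2` matches its two continuations of
  -- weight `ρ`.
  | some (l, i), s => if s = alternate l (i + 1) then ρ ^ (i + 1 : ℕ) else ρ ^ (r - i)

theorem one_le_loopWeight {ρ : ℝ} (hρ : 1 ≤ ρ) (o : Option (Bool × Fin r)) (s : Bool) :
    1 ≤ loopWeight ρ o s := by
  rcases o with _ | ⟨l, i⟩
  · norm_num [loopWeight]
  · simp only [loopWeight]
    split_ifs <;> exact one_le_pow₀ hρ

theorem loopWeight_le {ρ c : ℝ} (hρ : 1 ≤ ρ) (hc : ρ ^ (r + 1) ≤ c) (hc2 : 2 ≤ c)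
    (o : Option (Bool × Fin r)) (s : Bool) : loopWeight ρ o s ≤ c := by
  rcases o with _ | ⟨l, i⟩
  · exact hc2
  · simp only [loopWeight]
    split_ifs <;> exact (pow_le_pow_right₀ hρ (by omega)).trans hc

/-- The growth weight of a pair of loops, extended by `0`. -/
def pointWeight (v : Option (Bool × Fin r) → Fin n) (ρ : ℝ) (a : Fin n) (s : Bool) : ℝ :=
  ∑ o, if v o = a then loopWeight ρ o s else 0

theorem pointWeight_apply (v : Option (Bool × Fin r) ↪ Fin n) (ρ : ℝ)
    (o : Option (Bool × Fin r)) (s : Bool) : pointWeight v ρ (v o) s = loopWeight ρ o s := by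
  simp [pointWeight, v.injective.eq_iff]

theorem pointWeight_of_notMem (v : Option (Bool × Fin r) → Fin n) (ρ : ℝ) {a : Fin n}
    (ha : a ∉ Set.range v) (s : Bool) : pointWeight v ρ a s = 0 :=
  Finset.sum_eq_zero fun o _ => if_neg fun h => ha ⟨o, h⟩

theorem loopStep_of_notMem_left {v : Option (Bool × Fin r) → Fin n} {a : Fin n}
    (ha : a ∉ Set.range v) (s : Bool) (b : Fin n) : loopStep v s a b = 0 := by
  refine Set.indicator_of_notMem (fun h => ?_) _
  obtain ⟨l, p, -, -, ⟨rfl, -⟩ | ⟨rfl, -⟩⟩ := exists_of_mem_range_loopClause h <;>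
    exact ha ⟨_, rfl⟩

theorem loopStep_of_notMem_right {v : Option (Bool × Fin r) → Fin n} {b : Fin n}
    (hb : b ∉ Set.range v) (s : Bool) (a : Fin n) : loopStep v s a b = 0 := by
  refine Set.indicator_of_notMem (fun h => ?_) _
  obtain ⟨l, p, -, -, ⟨-, rfl⟩ | ⟨-, rfl⟩⟩ := exists_of_mem_range_loopClause h <;>
    exact hb ⟨_, rfl⟩

/-- Since `r + 1` is odd, the steps at the centre with sign `!s` are the first and the last step of
the loop `s`, the latter traversed backwards. -/
theorem sum_loopStep_center_le (hr : Even r) (hr0 : 0 < r) (v : Option (Bool × Fin r) ↪ Fin n)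
    (f : Fin n → ℝ) (hf : ∀ x, 0 ≤ f x) (s : Bool) :
    ∑ b, loopStep v (!s) (v none) b * f b ≤
      f (v (some (s, ⟨0, hr0⟩))) + f (v (some (s, ⟨r - 1, by omega⟩))) := by
  classical
  simp only [loopStep_eq]
  refine sum_ite_mul_le_of_eq_or_eq _ f hf _ _ fun x hx => ?_
  obtain ⟨l, p, hp, hs, ⟨h1, rfl⟩ | ⟨h1, rfl⟩⟩ := exists_of_mem_range_loopClause hx
  · have h2 := eq_zero_of_place_eq_none hp (v.injective h1).symm
    subst h2
    rw [place_succ l hr0]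
    rw [alternate_succ, alternate_zero, Bool.not_inj_iff] at hs
    exact Or.inl (by rw [hs])
  · have h2 : p = r := by
      by_contra h3
      rw [place_succ l (by omega : p < r)] at h1
      simpa using v.injective h1
    subst h2
    rw [alternate_of_odd l hr.add_one, Bool.not_inj_iff] at hs
    refine Or.inr ?_
    rw [hs, ← place_succ l (by omega : p - 1 < p), Nat.sub_add_cancel hr0]

/-- The two steps at an inner place have opposite signs, so an alternating walk cannot turn around
there. -/
theorem sum_loopStep_forward_le (v : Option (Bool × Fin r) ↪ Fin n)
    (f : Fin n → ℝ) (hf : ∀ x, 0 ≤ f x) (l : Bool) (i : Fin r) :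
    ∑ b, loopStep v (!alternate l (i + 1)) (v (some (l, i))) b * f b ≤
      f (v (place l (i + 2))) := by
  classical
  simp only [loopStep_eq]
  refine sum_ite_mul_le_of_eq _ f hf _ fun x hx => ?_
  obtain ⟨l', p, hp, hs, ⟨h1, rfl⟩ | ⟨h1, rfl⟩⟩ := exists_of_mem_range_loopClause hx
  · obtain ⟨rfl, rfl⟩ := eq_of_place_eq_some (v.injective h1).symm
    rfl
  · obtain ⟨rfl, h2⟩ := eq_of_place_eq_some (v.injective h1).symm
    obtain rfl : p = i := by omega
    simp at hs

theorem sum_loopStep_backward_le (v : Option (Bool × Fin r) ↪ Fin n)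
    (f : Fin n → ℝ) (hf : ∀ x, 0 ≤ f x) (l : Bool) (i : Fin r) :
    ∑ b, loopStep v (alternate l (i + 1)) (v (some (l, i))) b * f b ≤ f (v (place l i)) := by
  classical
  simp only [loopStep_eq]
  refine sum_ite_mul_le_of_eq _ f hf _ fun x hx => ?_
  obtain ⟨l', p, hp, hs, ⟨h1, rfl⟩ | ⟨h1, rfl⟩⟩ := exists_of_mem_range_loopClause hx
  · obtain ⟨rfl, rfl⟩ := eq_of_place_eq_some (v.injective h1).symm
    rw [alternate_succ _ ((i : ℕ) + 1)] at hs
    simp at hs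
  · obtain ⟨rfl, h2⟩ := eq_of_place_eq_some (v.injective h1).symm
    obtain rfl : p = i := by omega
    rfl

theorem loopWeight_place_forward_le {ρ : ℝ} (hρ2 : 2 ≤ ρ ^ (r + 1)) (l : Bool) (i : Fin r) :
    loopWeight ρ (place (r := r) l (i + 2)) (!alternate l (i + 1)) ≤ ρ * ρ ^ (i + 1 : ℕ) := by
  by_cases hi : (i : ℕ) + 1 < r
  · rw [place_succ l hi, loopWeight, if_pos (alternate_succ _ _).symm, pow_succ' ρ ((i : ℕ) + 1)]
  · have h1 : (i : ℕ) + 1 = r := by omega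
    rw [show (i : ℕ) + 2 = r + 1 by omega, place_last, h1, ← pow_succ']
    exact hρ2

theorem loopWeight_place_backward_le {ρ : ℝ} (hρ2 : 2 ≤ ρ ^ (r + 1)) (l : Bool) (i : Fin r) :
    loopWeight ρ (place (r := r) l i) (alternate l (i + 1)) ≤ ρ * ρ ^ (r - i) := by
  rw [← pow_succ']
  rcases Nat.eq_zero_or_pos (i : ℕ) with hi | hi
  · rw [hi, place_zero, Nat.sub_zero]
    exact hρ2
  · obtain ⟨k, hk⟩ := Nat.exists_eq_succ_of_ne_zero hi.ne'
    rw [hk, Nat.succ_eq_add_one, place_succ l (by omega : k < r), loopWeight, if_neg (by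
      simp only
      rw [alternate_succ l (k + 1)]
      simp)]
    simp only
    rw [show r - k = r - (k + 1) + 1 by omega]

/-- The weight gains a factor `ρ` per step away from the centre, and `2 ≤ ρ ^ (r + 1)` pays for the
branching on return. The bound `ρ ^ (r + 1) ≤ 3` keeps all `2 * r + 1` weights at most `3`, whence
the total `6 * (r + 1)`. -/
theorem isGrowthWeight_pointWeight (hr : Even r) (hr0 : 0 < r)
    (v : Option (Bool × Fin r) ↪ Fin n) {ρ : ℝ} (hρ : 1 ≤ ρ) (hρ2 : 2 ≤ ρ ^ (r + 1))
    (hρ3 : ρ ^ (r + 1) ≤ 3) :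
    IsGrowthWeight (loopStep v) (pointWeight v ρ) ρ (6 * (r + 1)) := by
  have hnn : ∀ a s, 0 ≤ pointWeight v ρ a s := fun a s => Finset.sum_nonneg fun o _ => by
    split_ifs
    · exact zero_le_one.trans (one_le_loopWeight hρ o s)
    · exact le_rfl
  have hdich : ∀ (l : Bool) (i : Fin r) (s : Bool),
      s = alternate l (i + 1) ∨ (!s) = alternate l (i + 1) := fun l i s => by
    cases s <;> cases alternate l (i + 1) <;> simp
  refine ⟨hnn, fun a s => ?_, fun a s => ?_, fun s => ?_⟩
  · by_cases ha : a ∈ Set.range v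
    · obtain ⟨_ | ⟨l, i⟩, rfl⟩ := ha
      · refine (sum_loopStep_center_le hr hr0 v _ (fun x => hnn x _) s).trans ?_
        simp only [pointWeight_apply, loopWeight]
        rw [if_pos (by simp [alternate_succ, alternate_zero]), if_neg (by
          rw [Nat.sub_add_cancel hr0, alternate_of_even s hr]; simp)]
        rw [show r - (r - 1) = 1 by omega, zero_add, pow_one]
        linarith
      · rcases hdich l i s with h | h
        · rw [transfer, h]
          refine (sum_loopStep_forward_le v _ (fun x => hnn x _) l i).trans ?_
          rw [pointWeight_apply, pointWeight_apply]
          refine (loopWeight_place_forward_le hρ2 l i).trans_eq ?_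
          rw [loopWeight, if_pos rfl]
        · rw [transfer, h]
          refine (sum_loopStep_backward_le v _ (fun x => hnn x _) l i).trans ?_
          rw [pointWeight_apply, pointWeight_apply]
          refine (loopWeight_place_backward_le hρ2 l i).trans_eq ?_
          rw [loopWeight, if_neg (by rw [← h]; simp)]
    · rw [pointWeight_of_notMem _ _ ha, mul_zero]
      exact (Finset.sum_eq_zero fun b _ => by rw [loopStep_of_notMem_left ha, zero_mul]).le
  · by_cases ha : a ∈ Set.range v
    · obtain ⟨o, rfl⟩ := ha
      have h1 : ∑ b, loopStep v (!s) (v o) b = ∑ b, loopStep v (!s) (v o) b * 1 := by simp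
      rw [h1]
      rw [pointWeight_apply]
      have h2 := one_le_loopWeight hρ o s
      rcases o with _ | ⟨l, i⟩
      · refine (sum_loopStep_center_le hr hr0 v _ (fun x => zero_le_one) s).trans ?_
        linarith
      · rcases hdich l i s with h | h
        · rw [h] at h2 ⊢
          refine (sum_loopStep_forward_le v _ (fun x => zero_le_one) l i).trans ?_
          linarith
        · rw [h]
          refine (sum_loopStep_backward_le v _ (fun x => zero_le_one) l i).trans ?_
          linarith
    · rw [pointWeight_of_notMem _ _ ha, mul_zero]
      exact (Finset.sum_eq_zero fun b _ => by rw [loopStep_of_notMem_left ha]).le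
  · unfold pointWeight
    rw [Finset.sum_comm]
    refine (Finset.sum_le_card_nsmul _ _ 3 fun o _ => ?_).trans ?_
    · simpa using loopWeight_le hρ hρ3 (by norm_num) o s
    · simp [Fintype.card_option]
      linarith

/-- Evaluation of a function on the points of a pair of loops at the common point and along the
two loops. -/
def loopEquiv (r : ℕ) (α : Type*) :
    (Option (Bool × Fin r) → α) ≃ α × (Bool → Fin r → α) where
  toFun f := (f none, fun l i => f (some (l, i)))
  invFun x := fun o => o.elim x.1 fun z => x.2 z.1 z.2
  left_inv f := by funext o; cases o <;> rfl
  right_inv x := rfl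

/-- The total weight of all pairs of loops, by the steps they share with a given pair. -/
theorem sum_prod_loopClause_le (v : Option (Bool × Fin r) → Fin n) {θ : ℝ} (hθ : 0 ≤ θ) :
    ∑ t : Option (Bool × Fin r) ↪ Fin n, ∏ j,
        (θ + (Set.range (loopClause v)).indicator 1 (loopClause t j)) ≤
      ∑ x, ∏ l, (transfer fun s a b => θ + loopStep v s a b)^[r + 1]
        (fun a _ => if a = x then 1 else 0) x l := by
  let g : (Option (Bool × Fin r) → Fin n) → ℝ := fun t =>
    ∏ j, (θ + (Set.range (loopClause v)).indicator 1 (loopClause t j))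
  have hg : ∀ t, 0 ≤ g t := fun t => Finset.prod_nonneg fun j _ =>
    add_nonneg hθ (Set.indicator_nonneg (fun _ _ => zero_le_one) _)
  -- Pairs with repeated points are added too; after fixing the common point the two loops become
  -- independent.
  calc _ ≤ ∑ t, g t := by
        have := Finset.sum_map (Finset.univ : Finset (Option (Bool × Fin r) ↪ Fin n))
          ⟨fun t => (t : Option (Bool × Fin r) → Fin n), DFunLike.coe_injective⟩ g
        simp only [Function.Embedding.coeFn_mk] at this
        rw [← this]
        exact Finset.sum_le_sum_of_subset_of_nonneg (Finset.subset_univ _) fun t _ _ => hg t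
    _ = ∑ x, ∑ y : Bool → Fin r → Fin n, ∏ l, ∏ p ∈ Finset.range (r + 1),
          (θ + loopStep v (alternate l (p + 1)) (path x (y l) x p) (path x (y l) x (p + 1))) := by
        rw [← (loopEquiv r (Fin n)).symm.sum_comp, Fintype.sum_prod_type]
        refine Finset.sum_congr rfl fun x _ => Finset.sum_congr rfl fun y _ => ?_
        simp only [g]
        rw [Fintype.prod_prod_type]
        refine Finset.prod_congr rfl fun l _ => ?_
        rw [Finset.prod_range]
        refine Finset.prod_congr rfl fun p _ => ?_
        simp only [loopClause, place, map_path ((loopEquiv r (Fin n)).symm (x, y))]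
        rfl
    _ = _ := by
        refine Finset.sum_congr rfl fun x _ => ?_
        simp_rw [← sum_prod_path]
        rw [Finset.prod_univ_sum, Fintype.piFinset_univ]

end Growth

/-! ### The law of a clause of the fully polarized model -/

theorem isProbabilityMeasure_seedLaw {n : ℕ} (hn : 2 ≤ n) (p : unitInterval) :
    IsProbabilityMeasure (seedLaw n 2 p) := by
  have h1 : IsProbabilityMeasure
      (uniformOn {v : Fin 2 → Fin n | Function.Injective v}) :=
    isProbabilityMeasure_uniformOn (Set.toFinite _) ⟨Fin.castLE hn, Fin.castLE_injective hn⟩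
  have h2 : IsProbabilityMeasure (uniformOn (Set.univ : Set Bool)) :=
    isProbabilityMeasure_uniformOn Set.finite_univ Set.univ_nonempty
  rw [seedLaw]
  infer_instance

theorem uniformOn_injective_pair {n : ℕ} {u v : Fin n} (huv : u ≠ v) :
    uniformOn {w : Fin 2 → Fin n | Function.Injective w} {![u, v], ![v, u]} =
      2 / ((n : ENNReal) * (n - 1 : ℕ)) := by
  classical
  have h1 : {w : Fin 2 → Fin n | Function.Injective w} =
      ((Finset.univ.filter fun w : Fin 2 → Fin n => Function.Injective w : Finset _) :
        Set (Fin 2 → Fin n)) := by ext; simp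
  have h2 : ({![u, v], ![v, u]} : Set (Fin 2 → Fin n)) =
      (({![u, v], ![v, u]} : Finset (Fin 2 → Fin n)) : Set (Fin 2 → Fin n)) := by simp
  have h3 : (Finset.univ.filter fun w : Fin 2 → Fin n => Function.Injective w).card =
      n * (n - 1) := by
    rw [← Fintype.card_subtype,
      Fintype.card_congr (Equiv.subtypeInjectiveEquivEmbedding (Fin 2) (Fin n)),
      Fintype.card_embedding_eq]
    simp [Nat.descFactorial, mul_comm]
  have hinj : ∀ {a b : Fin n}, a ≠ b → Function.Injective ![a, b] := fun {a b} hab i j hij => by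
    fin_cases i <;> fin_cases j <;> simp_all [eq_comm]
  rw [h1, h2, uniformOn_apply_finset, Finset.inter_eq_right.2, h3, Finset.card_pair]
  · push_cast; rfl
  · intro h
    exact huv (congrFun h 0)
  · intro w hw
    rw [Finset.mem_insert, Finset.mem_singleton] at hw
    rcases hw with rfl | rfl
    · exact Finset.mem_filter.2 ⟨Finset.mem_univ _, hinj huv⟩
    · exact Finset.mem_filter.2 ⟨Finset.mem_univ _, hinj huv.symm⟩

/-- For `p = 0` both place signs are almost surely `false`, so the clause has sign `!B`. Two of the
`n * (n - 1)` ordered pairs give the right variables, and the coin contributes `1 / 2`. -/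
theorem seedLaw_real_clause_eq {n : ℕ} {u v : Fin n} (huv : u ≠ v) (b : Bool) :
    (seedLaw n 2 0).real {s | s.clause = {(u, b), (v, b)}} = 1 / ((n : ℝ) * (n - 1)) := by
  have hn : 2 ≤ n := by
    have := u.2
    have := v.2
    have : (u : ℕ) ≠ v := fun h => huv (Fin.ext h)
    omega
  have := isProbabilityMeasure_seedLaw hn 0
  have h1 : IsProbabilityMeasure
      (uniformOn {v : Fin 2 → Fin n | Function.Injective v}) :=
    isProbabilityMeasure_uniformOn (Set.toFinite _) ⟨Fin.castLE hn, Fin.castLE_injective hn⟩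
  have h2 : IsProbabilityMeasure (uniformOn (Set.univ : Set Bool)) :=
    isProbabilityMeasure_uniformOn Set.finite_univ Set.univ_nonempty
  let c : Fin 2 → Bool := fun _ => false
  let G : Set (Seed n 2) := Set.univ ×ˢ (Set.univ ×ˢ {c})
  have hc : (Measure.pi fun _ : Fin 2 => bernoulliMeasure true false (0 : unitInterval)) {c} =
      1 := by
    rw [← Set.univ_pi_singleton, Measure.pi_pi]
    simp [c, bernoulliMeasure_zero]
  have hG : seedLaw n 2 0 Gᶜ = 0 := by
    rw [prob_compl_eq_zero_iff MeasurableSet.of_discrete, seedLaw, Measure.prod_prod,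
      Measure.prod_prod, hc, measure_univ, measure_univ, one_mul, one_mul]
  have hS : {s : Seed n 2 | s.clause = {(u, b), (v, b)}} ∩ G =
      {![u, v], ![v, u]} ×ˢ ({!b} ×ˢ {c}) := by
    ext ⟨K, B, P⟩
    simp only [Set.mem_inter_iff, Set.mem_ofPred_eq, Set.mem_prod, Set.mem_univ, true_and,
      Set.mem_singleton_iff, Set.mem_insert_iff, G]
    constructor
    · rintro ⟨h, rfl⟩
      have h' : ({(K 0, !B), (K 1, !B)} : Clause n) = {(u, b), (v, b)} := by
        rw [← h]
        ext z
        simp [Seed.clause, c, Fin.exists_fin_two, eq_comm]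
      obtain ⟨h3, h4⟩ := eq_of_pair_eq_pair h'
      refine ⟨?_, by simp [← h3], rfl⟩
      rcases h4 with ⟨h4, h5⟩ | ⟨h4, h5⟩
      · left; ext i; fin_cases i <;> simp [h4, h5]
      · right; ext i; fin_cases i <;> simp [h4, h5]
    · rintro ⟨h3, rfl, rfl⟩
      refine ⟨?_, rfl⟩
      rcases h3 with rfl | rfl <;> ext z <;>
        simp [Seed.clause, c, Fin.exists_fin_two, eq_comm, or_comm]
  have hU : uniformOn (Set.univ : Set Bool) {!b} = 1 / 2 := by
    rw [uniformOn_univ]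
    simp
  rw [measureReal_def, ← measure_inter_conull hG, hS, seedLaw, Measure.prod_prod,
    Measure.prod_prod, uniformOn_injective_pair huv, hc, hU]
  have h3 : ((n - 1 : ℕ) : ℝ) = n - 1 := by rw [Nat.cast_sub (by omega)]; simp
  simp only [ENNReal.toReal_mul, ENNReal.toReal_div, ENNReal.toReal_natCast, h3,
    ENNReal.toReal_ofNat, ENNReal.toReal_one]
  generalize (n : ℝ) - 1 = d
  ring

theorem isProbabilityMeasure_modelLaw {n : ℕ} (hn : 2 ≤ n) (p : unitInterval) (m : ℕ) :
    IsProbabilityMeasure (modelLaw n 2 p m) := by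
  have := isProbabilityMeasure_seedLaw hn p
  rw [modelLaw]
  infer_instance

theorem prob_mono {n m : ℕ} (hn : 2 ≤ n) (p : unitInterval) {Q Q' : Formula n m → Prop}
    (h : ∀ F, Q F → Q' F) : prob n 2 p m Q ≤ prob n 2 p m Q' := by
  have := isProbabilityMeasure_modelLaw hn p m
  exact measureReal_mono fun ω hω => h _ hω

theorem prob_le_one {n m : ℕ} (hn : 2 ≤ n) (p : unitInterval) (Q : Formula n m → Prop) :
    prob n 2 p m Q ≤ 1 := by
  have := isProbabilityMeasure_modelLaw hn p m
  exact measureReal_le_one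

/-- The second moment bound for the number of unicycles of length `2 * (r + 1)`. -/
theorem descFactorial_mul_le_prob_mul {n m r : ℕ} (hn : 2 ≤ n) (hr : Even r) (hr2 : 2 ≤ r) {q : ℝ}
    (hq : q = 1 / ((n : ℝ) * (n - 1))) (C : ℝ) (hC0 : 0 ≤ C)
    (hC : ∀ v : Option (Bool × Fin r) ↪ Fin n,
      ∑ x, ∏ l, (transfer fun s a b => m * q + loopStep v s a b)^[r + 1]
        (fun a _ => if a = x then 1 else 0) x l ≤ C) :
    (n.descFactorial (2 * r + 1) : ℝ) * m.descFactorial (2 * (r + 1)) * q ^ (2 * (r + 1)) ≤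
      prob n 2 0 m (fun F => HasUnicycle (implicationDigraph F)) * C := by
  classical
  have := isProbabilityMeasure_seedLaw hn 0
  have := isProbabilityMeasure_modelLaw hn 0 m
  have hn1 : (2 : ℝ) ≤ n := by exact_mod_cast hn
  have hq0 : 0 ≤ q := by
    rw [hq]
    exact div_nonneg zero_le_one (mul_nonneg (by linarith) (by linarith))
  let _ : MeasurableSpace (Clause n) := ⊤
  have hdis : DiscreteMeasurableSpace (Clause n) := ⟨fun _ => trivial⟩
  have hmeas : Measurable (Seed.clause (n := n) (k := 2)) := fun _ _ => MeasurableSet.of_discrete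
  have hlaw : ∀ (v : Option (Bool × Fin r) ↪ Fin n) (j : Bool × Fin (r + 1)),
      (seedLaw n 2 0).real {s | s.clause = loopClause v j} = q := fun v j => by
    rw [hq]
    exact seedLaw_real_clause_eq (fun h => place_ne_place_succ hr2 _ _ (v.injective h)) _
  have hbound := fun v : Option (Bool × Fin r) ↪ Fin n =>
    (sum_prod_loopClause_le v (θ := m * q) (by positivity)).trans (hC v)
  have h1 := card_mul_le_mul_pi_real (seedLaw n 2 0) (m := m) (q := q) Seed.clause
    hmeas (fun v : Option (Bool × Fin r) ↪ Fin n => loopClause v)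
    (fun v => loopClause_injective hr2 v) hq0 hlaw C hC0 hbound
  have h2 : Fintype.card (Bool × Fin (r + 1)) = 2 * (r + 1) := by simp
  have h3 : Fintype.card (Option (Bool × Fin r) ↪ Fin n) = n.descFactorial (2 * r + 1) := by
    rw [Fintype.card_embedding_eq]
    simp
  rw [h2, h3] at h1
  refine h1.trans (mul_le_mul_of_nonneg_right ?_ hC0)
  rw [prob]
  refine measureReal_mono ?_
  rintro ω ⟨v, φ, h⟩
  exact hasUnicycle_of_loopClause hr _ v fun j => ⟨φ j, h j⟩

/-! ### Quantitative bounds -/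

/-- Bernoulli's inequality for `(1 - j / n) ^ j`; for `j > n` the left side is not positive. -/
theorem pow_mul_le_descFactorial {n : ℕ} (hn : 0 < n) (j : ℕ) :
    (n : ℝ) ^ j * (1 - (j : ℝ) ^ 2 / n) ≤ n.descFactorial j := by
  have hn' : (0 : ℝ) < n := by exact_mod_cast hn
  rcases le_or_gt j n with h | h
  · have h1 : ((n - j : ℕ) : ℝ) ^ j ≤ n.descFactorial j := by
      exact_mod_cast (Nat.pow_le_pow_left (by omega) j).trans (Nat.pow_sub_le_descFactorial n j)
    refine le_trans ?_ h1
    have h2 : ((n - j : ℕ) : ℝ) = n * (1 + -(j / n)) := by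
      rw [Nat.cast_sub h]
      field_simp
      ring
    have h3 : (j : ℝ) / n ≤ 1 := by
      rw [div_le_one hn']
      exact_mod_cast h
    rw [h2, mul_pow]
    refine mul_le_mul_of_nonneg_left ?_ (by positivity)
    refine le_trans (le_of_eq ?_) (one_add_mul_le_pow (by linarith) j)
    ring
  · have h1 : 1 - (j : ℝ) ^ 2 / n ≤ 0 := by
      rw [sub_nonpos, le_div_iff₀ hn', one_mul]
      have : n ≤ j ^ 2 := h.le.trans (Nat.le_self_pow two_ne_zero j)
      exact_mod_cast this
    exact (mul_nonpos_of_nonneg_of_nonpos (by positivity) h1).trans (by positivity)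

theorem two_le_one_add_inv_pow {k : ℕ} (hk : 0 < k) : 2 ≤ (1 + 1 / (k : ℝ)) ^ k := by
  have hk' : (0 : ℝ) < k := by exact_mod_cast hk
  refine le_trans (le_of_eq ?_) (one_add_mul_le_pow
    (show (-2 : ℝ) ≤ 1 / k by linarith [show 0 ≤ 1 / (k : ℝ) by positivity]) k)
  field_simp
  norm_num

theorem one_add_inv_pow_le_three {k : ℕ} (hk : 0 < k) : (1 + 1 / (k : ℝ)) ^ k ≤ 3 := by
  have hk' : (0 : ℝ) < k := by exact_mod_cast hk
  calc (1 + 1 / (k : ℝ)) ^ k ≤ (Real.exp (1 / k)) ^ k := by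
        refine pow_le_pow_left₀ (by positivity) ?_ k
        linarith [Real.add_one_le_exp (1 / (k : ℝ))]
    _ = Real.exp 1 := by rw [← Real.exp_nat_mul]; congr 1; field_simp
    _ ≤ 3 := by linarith [Real.exp_one_lt_d9]

/-- Bound for the total weight of the pairs of loops, by the steps shared with a given pair. -/
theorem sum_prod_iterate_transfer_le {n r : ℕ} (hr : Even r) (hr0 : 0 < r) (hn : 0 < n)
    (v : Option (Bool × Fin r) ↪ Fin n) {θ ε : ℝ} (hθ : 0 ≤ θ) (hε : 0 < ε)
    (hεθ : 1 + ε ≤ n * θ) (hεr : 2 ≤ ε * (r + 1)) :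
    ∑ x, ∏ l, (transfer fun s a b => θ + loopStep v s a b)^[r + 1]
        (fun a _ => if a = x then 1 else 0) x l ≤
      (n * θ) ^ (2 * (r + 1)) / n * ((1 + 24 * (r + 1) / (ε * n)) ^ (2 * (r + 1)) +
        2 * (r + 1) * n * (9 / (1 + ε) ^ (r + 1) +
          6 * (r + 1) ^ 2 * (1 + 24 * (r + 1) / (ε * n)) ^ (r + 1) * (1 + 12 / ε) / n) ^ 2) := by
  classical
  have hn' : (0 : ℝ) < n := by exact_mod_cast hn
  set ρ : ℝ := 1 + 1 / ((r + 1 : ℕ) : ℝ) with hρdef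
  -- Since `ρ ≤ 1 + ε / 2`, the gap `n * θ - ρ` is at least `ε / 2`, so this `K` gives `2 ≤ K * (n *
  -- θ - ρ)`. With `Ψ = 6 * (r + 1)` the growth rate is then `μ * d`.
  set K : ℝ := 4 / ε with hKdef
  set μ : ℝ := n * θ with hμ
  set d : ℝ := 1 + 24 * (r + 1) / (ε * n) with hd
  have hd1 : 1 ≤ d := le_add_of_nonneg_right (by positivity)
  have hμ0 : 0 < μ := by linarith
  have hK0 : 0 ≤ K := by positivity
  have hρ1 : 1 ≤ ρ := le_add_of_nonneg_right (by positivity)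
  have hρε : ρ ≤ 1 + ε / 2 := by
    rw [hρdef]
    push_cast
    have : 1 / ((r : ℝ) + 1) ≤ ε / 2 := by
      rw [div_le_div_iff₀ (by positivity) (by norm_num)]
      linarith
    linarith
  have hρ2 := two_le_one_add_inv_pow (Nat.succ_pos r)
  have hρ3 := one_add_inv_pow_le_three (Nat.succ_pos r)
  have hg := isGrowthWeight_pointWeight hr hr0 v hρ1 hρ2 hρ3
  have hKρ : 2 ≤ K * (Fintype.card (Fin n) * θ - ρ) := by
    rw [Fintype.card_fin]
    have h1 : ε / 2 ≤ n * θ - ρ := by linarith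
    calc (2 : ℝ) = K * (ε / 2) := by rw [hKdef]; field_simp; norm_num
      _ ≤ _ := mul_le_mul_of_nonneg_left h1 hK0
  have hA := loopStep_nonneg (v : Option (Bool × Fin r) → Fin n)
  have hγ : Fintype.card (Fin n) * θ + θ * (K * (6 * (r + 1))) = μ * d := by
    rw [Fintype.card_fin, hμ, hd, hKdef]
    field_simp
    ring
  have hnonneg : ∀ x l, 0 ≤ (transfer fun s a b => θ + loopStep v s a b)^[r + 1]
      (fun a _ => if a = x then 1 else 0) x l := fun x l => by
    rw [← sum_prod_path]
    exact Finset.sum_nonneg fun y _ => Finset.prod_nonneg fun p _ => add_nonneg hθ (hA _ _ _)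
  -- `B0` bounds one loop based off the given pair, `B1` one based on it. The `9` is `3 * 3`, from
  -- `ρ ^ (r + 1) ≤ 3` and weights at most `3`; the second term of `B1` accounts for walks with a
  -- free step.
  set B0 : ℝ := μ ^ (r + 1) * d ^ (r + 1) / n with hB0
  set B1 : ℝ := μ ^ (r + 1) * (9 / (1 + ε) ^ (r + 1) +
    6 * (r + 1) ^ 2 * d ^ (r + 1) * (1 + 12 / ε) / n) with hB1
  have hθμ : θ * μ ^ r = μ ^ (r + 1) / n := by
    rw [pow_succ, hμ]
    field_simp
  have hout : ∀ x, x ∉ Set.range v → ∀ l, (transfer fun s a b => θ + loopStep v s a b)^[r + 1]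
      (fun a _ => if a = x then 1 else 0) x l ≤ B0 := fun x hx l => by
    refine (hg.iterate_le_of_forall_eq_zero hA hθ hK0 hKρ x
      (fun s u => loopStep_of_notMem_right hx s u) r x l).trans ?_
    rw [hγ, pointWeight_of_notMem _ _ hx, mul_zero, add_zero, mul_one, mul_pow, ← mul_assoc, hθμ,
      hB0, div_mul_eq_mul_div]
    gcongr
    omega
  have hin : ∀ x, x ∈ Set.range v → ∀ l, (transfer fun s a b => θ + loopStep v s a b)^[r + 1]
      (fun a _ => if a = x then 1 else 0) x l ≤ B1 := fun x hx l => by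
    obtain ⟨o, rfl⟩ := hx
    refine (hg.iterate_le hA hθ hK0 (zero_le_one.trans hρ1)
      (by rw [Fintype.card_fin]; linarith) hKρ (v o)
      (fun s => by rw [pointWeight_apply]; exact one_le_loopWeight hρ1 o s) (r + 1) (v o) l).trans ?_
    have h1 := loopWeight_le hρ1 hρ3 (by norm_num) o l
    have h2 := one_le_loopWeight hρ1 o l
    rw [pointWeight_apply, hγ, Nat.add_sub_cancel, hB1, mul_add (μ ^ (r + 1))]
    refine add_le_add ?_ ?_
    · have h3 : (1 : ℝ) ≤ μ ^ (r + 1) / (1 + ε) ^ (r + 1) := by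
        rw [one_le_div (by positivity)]
        exact pow_le_pow_left₀ (by positivity) hεθ _
      calc ρ ^ (r + 1) * loopWeight ρ o l ≤ 3 * 3 :=
            mul_le_mul hρ3 h1 (by linarith) (by norm_num)
        _ ≤ 9 * (μ ^ (r + 1) / (1 + ε) ^ (r + 1)) := by linarith
        _ = _ := by ring
    · have h3 : 1 + K * loopWeight ρ o l ≤ 1 + 12 / ε := by
        have := mul_le_mul_of_nonneg_left h1 hK0
        rw [show (12 : ℝ) / ε = K * 3 by rw [hKdef]; ring]
        linarith
      have h4 : d ^ r ≤ d ^ (r + 1) := pow_le_pow_right₀ hd1 (by omega)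
      calc ((r + 1 : ℕ) : ℝ) * (θ * (6 * (r + 1))) * (μ * d) ^ r * (1 + K * loopWeight ρ o l)
          = 6 * (r + 1) ^ 2 * (θ * μ ^ r) * d ^ r * (1 + K * loopWeight ρ o l) := by
            rw [mul_pow]; push_cast; ring
        _ ≤ 6 * (r + 1) ^ 2 * (θ * μ ^ r) * d ^ (r + 1) * (1 + 12 / ε) := by
            gcongr
        _ = _ := by rw [hθμ]; ring
  have hterm : ∀ x, ∏ l, (transfer fun s a b => θ + loopStep v s a b)^[r + 1]
      (fun a _ => if a = x then 1 else 0) x l ≤ B0 ^ 2 + if x ∈ Set.range v then B1 ^ 2 else 0 := by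
    intro x
    have hB0nn : 0 ≤ B0 ^ 2 := by positivity
    split_ifs with hx
    · have := Finset.prod_le_prod (s := Finset.univ) (fun l _ => hnonneg x l)
        (fun l _ => hin x hx l)
      simp only [Finset.prod_const, Finset.card_univ, Fintype.card_bool] at this
      linarith
    · have := Finset.prod_le_prod (s := Finset.univ) (fun l _ => hnonneg x l)
        (fun l _ => hout x hx l)
      simp only [Finset.prod_const, Finset.card_univ, Fintype.card_bool] at this
      linarith
  have hcard : ((Finset.univ.filter fun x => x ∈ Set.range v).card : ℝ) ≤ 2 * (r + 1) := by
    have h1 : (Finset.univ.filter fun x => x ∈ Set.range v) = Finset.univ.map v := by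
      ext x; simp
    rw [h1, Finset.card_map]
    simp [Fintype.card_option]
    linarith
  calc _ ≤ ∑ x : Fin n, (B0 ^ 2 + if x ∈ Set.range v then B1 ^ 2 else 0) :=
        Finset.sum_le_sum fun x _ => hterm x
    _ = n * B0 ^ 2 + (Finset.univ.filter fun x => x ∈ Set.range v).card * B1 ^ 2 := by
        rw [Finset.sum_add_distrib, ← Finset.sum_filter]
        simp
    _ ≤ n * B0 ^ 2 + 2 * (r + 1) * B1 ^ 2 := by gcongr
    _ = _ := by
        rw [hB0, hB1]
        field_simp
        ring

/-- The factor `(n * θ) ^ (2 * (r + 1)) / n = n ^ (2 * r + 1) * (m * q) ^ (2 * (r + 1))` is the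
first moment without the falling-factorial corrections. It cancels from the second moment bound, and
each of the two corrections costs one factor of the squared left side. -/
theorem sq_one_sub_le_prob_mul {n m r : ℕ} (hr : Even r) (hr2 : 2 ≤ r)
    (hn : 4 * ((r : ℝ) + 1) ^ 2 ≤ n) {ε : ℝ} (hε : 0 < ε) (hm : (1 + ε) * n ≤ m)
    (hεr : 2 ≤ ε * (r + 1)) :
    (1 - 4 * ((r : ℝ) + 1) ^ 2 / n) ^ 2 ≤
      prob n 2 0 m (fun F => HasUnicycle (implicationDigraph F)) *
      ((1 + 24 * (r + 1) / (ε * n)) ^ (2 * (r + 1)) +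
        2 * (r + 1) * n * (9 / (1 + ε) ^ (r + 1) +
          6 * (r + 1) ^ 2 * (1 + 24 * (r + 1) / (ε * n)) ^ (r + 1) * (1 + 12 / ε) / n) ^ 2) := by
  have hr' : (2 : ℝ) ≤ r := by exact_mod_cast hr2
  have hn4 : (4 : ℝ) ≤ n := by nlinarith
  have hn0 : (0 : ℝ) < n := by linarith
  have hnN : 2 ≤ n := by
    have : 4 ≤ n := by exact_mod_cast hn4
    omega
  have hmn : (n : ℝ) ≤ m := by nlinarith
  have hm0 : (0 : ℝ) < m := by linarith
  set q : ℝ := 1 / ((n : ℝ) * (n - 1)) with hq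
  have hq0 : 0 < q := by
    have : (0 : ℝ) < n - 1 := by linarith
    positivity
  set θ : ℝ := m * q with hθ
  have hθ0 : 0 < θ := by positivity
  have hεθ : 1 + ε ≤ n * θ := by
    have h1 : n * θ = m / (n - 1) := by
      have : (0 : ℝ) < n - 1 := by linarith
      rw [hθ, hq]
      field_simp
    rw [h1, le_div_iff₀ (by linarith)]
    nlinarith
  set E : ℝ := ((1 + 24 * (r + 1) / (ε * n)) ^ (2 * (r + 1)) +
        2 * (r + 1) * n * (9 / (1 + ε) ^ (r + 1) +
          6 * (r + 1) ^ 2 * (1 + 24 * (r + 1) / (ε * n)) ^ (r + 1) * (1 + 12 / ε) / n) ^ 2)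
    with hE
  have hE0 : 0 ≤ E := by positivity
  have h1 := descFactorial_mul_le_prob_mul (m := m) hnN hr hr2 hq ((n * θ) ^ (2 * (r + 1)) / n * E)
    (by positivity) fun v => sum_prod_iterate_transfer_le hr (by omega) (by omega) v hθ0.le hε hεθ
      hεr
  set P := prob n 2 0 m (fun F => HasUnicycle (implicationDigraph F))
  have h2 := pow_mul_le_descFactorial (show 0 < n by omega) (2 * r + 1)
  have h3 := pow_mul_le_descFactorial (show 0 < m by exact_mod_cast hm0) (2 * (r + 1))
  set z : ℝ := 1 - 4 * ((r : ℝ) + 1) ^ 2 / n with hz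
  have hz0 : 0 ≤ z := by
    rw [hz, sub_nonneg, div_le_one hn0]
    exact hn
  have h4 : z ≤ 1 - ((2 * r + 1 : ℕ) : ℝ) ^ 2 / n := by
    rw [hz]
    gcongr
    push_cast
    nlinarith
  have h5 : z ≤ 1 - ((2 * (r + 1) : ℕ) : ℝ) ^ 2 / m := by
    rw [hz]
    gcongr
    push_cast
    nlinarith
  have h6 : (n : ℝ) ^ (2 * r + 1) * z ≤ n.descFactorial (2 * r + 1) :=
    (mul_le_mul_of_nonneg_left h4 (by positivity)).trans h2
  have h7 : (m : ℝ) ^ (2 * (r + 1)) * z ≤ m.descFactorial (2 * (r + 1)) :=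
    (mul_le_mul_of_nonneg_left h5 (by positivity)).trans h3
  have h8 : ((n * θ) ^ (2 * (r + 1)) / n) * z ^ 2 ≤
      ((n * θ) ^ (2 * (r + 1)) / n) * (P * E) := by
    calc ((n * θ) ^ (2 * (r + 1)) / n) * z ^ 2
        = ((n : ℝ) ^ (2 * r + 1) * z) * ((m : ℝ) ^ (2 * (r + 1)) * z) * q ^ (2 * (r + 1)) := by
          rw [hθ, mul_pow, mul_pow, show 2 * (r + 1) = 2 * r + 1 + 1 by ring, pow_succ (n : ℝ)]
          field_simp
      _ ≤ n.descFactorial (2 * r + 1) * m.descFactorial (2 * (r + 1)) * q ^ (2 * (r + 1)) := by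
          gcongr
      _ ≤ _ := h1.trans_eq (by ring)
  exact le_of_mul_le_mul_left h8 (by positivity)

/-! ### Asymptotics -/

/-- Half the length of the unicycles that are counted, minus one. -/
noncomputable def loopLength (n : ℕ) : ℕ := 2 * ⌊(n : ℝ) ^ (1 / 9 : ℝ)⌋₊ + 2

theorem even_loopLength (n : ℕ) : Even (loopLength n) :=
  (even_two_mul _).add even_two

theorem loopLength_add_one_le {n : ℕ} (hn : 1 ≤ n) :
    (loopLength n : ℝ) + 1 ≤ 5 * (n : ℝ) ^ (1 / 9 : ℝ) := by
  have h1 : (1 : ℝ) ≤ (n : ℝ) ^ (1 / 9 : ℝ) :=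
    Real.one_le_rpow (by exact_mod_cast hn) (by norm_num)
  have h2 := Nat.floor_le (show 0 ≤ (n : ℝ) ^ (1 / 9 : ℝ) by positivity)
  rw [loopLength]
  push_cast
  linarith

theorem le_loopLength_add_one (n : ℕ) :
    2 * (n : ℝ) ^ (1 / 9 : ℝ) ≤ (loopLength n : ℝ) + 1 := by
  have h2 := Nat.lt_floor_add_one ((n : ℝ) ^ (1 / 9 : ℝ))
  rw [loopLength]
  push_cast
  linarith

theorem tendsto_natCast_rpow_neg {s : ℝ} (hs : 0 < s) :
    Tendsto (fun n : ℕ => (n : ℝ) ^ (-s)) atTop (𝓝 0) :=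
  (tendsto_rpow_neg_atTop hs).comp tendsto_natCast_atTop_atTop

/-- The logarithm of the right side is at least `n ^ (1/9 - 1/10) = n ^ (1/90)`, which beats `log
n`. This is why the loops are longer than `n ^ (1/10)`. -/
theorem eventually_le_one_add_rpow_pow :
    ∀ᶠ n : ℕ in atTop,
      (n : ℝ) ≤ (1 + (n : ℝ) ^ (-(1 / 10) : ℝ)) ^ (loopLength n + 1) := by
  have h1 := (isLittleO_log_rpow_atTop (show (0 : ℝ) < 1 / 90 by norm_num)).bound zero_lt_one
  filter_upwards [tendsto_natCast_atTop_atTop.eventually h1, eventually_ge_atTop 1] with n h2 hn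
  have hn1 : (1 : ℝ) ≤ n := by exact_mod_cast hn
  have hn0 : (0 : ℝ) < n := by linarith
  rw [one_mul, Real.norm_of_nonneg (Real.log_nonneg hn1),
    Real.norm_of_nonneg (by positivity)] at h2
  set e := (n : ℝ) ^ (-(1 / 10) : ℝ) with he
  have he0 : 0 < e := by positivity
  have he1 : e ≤ 1 := Real.rpow_le_one_of_one_le_of_nonpos hn1 (by norm_num)
  have h3 := Real.le_log_one_add_of_nonneg he0.le
  have h4 : e / 2 ≤ 2 * e / (e + 2) := by
    rw [div_le_div_iff₀ (by norm_num) (by positivity)]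
    nlinarith
  have h5 := le_loopLength_add_one n
  have h6 : (n : ℝ) ^ (1 / 90 : ℝ) ≤ ((loopLength n : ℝ) + 1) * Real.log (1 + e) := by
    calc (n : ℝ) ^ (1 / 90 : ℝ) = (2 * (n : ℝ) ^ (1 / 9 : ℝ)) * (e / 2) := by
          rw [he, show (1 / 90 : ℝ) = 1 / 9 + -(1 / 10) by norm_num, Real.rpow_add hn0]
          ring
      _ ≤ _ := mul_le_mul h5 (h4.trans h3) (by positivity) (by positivity)
  calc (n : ℝ) = Real.exp (Real.log n) := (Real.exp_log hn0).symm
    _ ≤ Real.exp (((loopLength n + 1 : ℕ) : ℝ) * Real.log (1 + e)) := by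
        push_cast
        exact Real.exp_le_exp.2 (h2.trans h6)
    _ = _ := by rw [Real.exp_nat_mul, Real.exp_log (by positivity)]

/-- With `a = n ^ (1/9)` and `e = n ^ (-1/10)`, all corrections are governed by `a ^ 2 / (e * n) = n
^ (-61/90)`. Base points on the given pair contribute order `a * n * (n ^ (-61/90)) ^ 2 = n ^
(-11/45)`, so the loops are still short enough. -/
theorem eventually_error_le :
    ∀ᶠ n : ℕ in atTop,
      (1 + 24 * ((loopLength n : ℝ) + 1) / ((n : ℝ) ^ (-(1 / 10) : ℝ) * n)) ^
          (2 * (loopLength n + 1)) +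
        2 * ((loopLength n : ℝ) + 1) * n *
          (9 / (1 + (n : ℝ) ^ (-(1 / 10) : ℝ)) ^ (loopLength n + 1) +
          6 * ((loopLength n : ℝ) + 1) ^ 2 *
            (1 + 24 * ((loopLength n : ℝ) + 1) / ((n : ℝ) ^ (-(1 / 10) : ℝ) * n)) ^
              (loopLength n + 1) * (1 + 12 / (n : ℝ) ^ (-(1 / 10) : ℝ)) / n) ^ 2 ≤
      Real.exp (1200 * (n : ℝ) ^ (-(61 / 90) : ℝ)) +
        10 * 3909 ^ 2 * (n : ℝ) ^ (-(11 / 45) : ℝ) := by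
  have hlim : Tendsto (fun n : ℕ => Real.exp (1200 * (n : ℝ) ^ (-(61 / 90) : ℝ))) atTop (𝓝 1) := by
    have := ((tendsto_natCast_rpow_neg (show (0 : ℝ) < 61 / 90 by norm_num)).const_mul
      1200).rexp
    simpa using this
  filter_upwards [eventually_le_one_add_rpow_pow, eventually_ge_atTop 1,
    hlim.eventually_le_const (show (1 : ℝ) < 2 by norm_num)] with n hpow hn hexp
  have hn1 : (1 : ℝ) ≤ n := by exact_mod_cast hn
  have hn0 : (0 : ℝ) < n := by linarith
  set e := (n : ℝ) ^ (-(1 / 10) : ℝ) with he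
  have he0 : 0 < e := by positivity
  have he1 : e ≤ 1 := Real.rpow_le_one_of_one_le_of_nonpos hn1 (by norm_num)
  set R : ℝ := (loopLength n : ℝ) + 1 with hR
  set a : ℝ := (n : ℝ) ^ (1 / 9 : ℝ) with ha
  have ha0 : 0 < a := by positivity
  have hR0 : 0 < R := by positivity
  have hRa : R ≤ 5 * a := loopLength_add_one_le hn
  have hkey : a ^ 2 / (e * n) = (n : ℝ) ^ (-(61 / 90) : ℝ) := by
    rw [div_eq_iff (by positivity), ha, he, ← Real.rpow_natCast, ← Real.rpow_mul hn0.le,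
      ← Real.rpow_add_one hn0.ne', ← Real.rpow_add hn0]
    norm_num
  have hkey2 : a * n * ((n : ℝ) ^ (-(61 / 90) : ℝ)) ^ 2 = (n : ℝ) ^ (-(11 / 45) : ℝ) := by
    rw [ha, ← Real.rpow_natCast (_ ^ _) 2, ← Real.rpow_mul hn0.le, ← Real.rpow_add_one hn0.ne',
      ← Real.rpow_add hn0]
    norm_num
  set b : ℝ := (n : ℝ) ^ (-(61 / 90) : ℝ) with hb
  have hb0 : 0 < b := by positivity
  set x : ℝ := 24 * R / (e * n) with hx
  have hx0 : 0 ≤ x := by positivity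
  have hR2 : R ^ 2 ≤ 25 * a ^ 2 := by nlinarith
  have hRx : 2 * R * x ≤ 1200 * b := by
    rw [← hkey, hx, show 2 * R * (24 * R / (e * n)) = 48 * (R ^ 2 / (e * n)) by ring]
    calc 48 * (R ^ 2 / (e * n)) ≤ 48 * (25 * a ^ 2 / (e * n)) := by gcongr
      _ = _ := by ring
  have hcast : ((2 * (loopLength n + 1) : ℕ) : ℝ) = 2 * R := by push_cast; rfl
  have h1 : (1 + x) ^ (2 * (loopLength n + 1)) ≤ Real.exp (1200 * b) := by
    calc (1 + x) ^ (2 * (loopLength n + 1)) ≤ Real.exp x ^ (2 * (loopLength n + 1)) :=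
          pow_le_pow_left₀ (by positivity) (by linarith [Real.add_one_le_exp x]) _
      _ = Real.exp (2 * R * x) := by rw [← Real.exp_nat_mul, hcast]
      _ ≤ _ := Real.exp_le_exp.2 hRx
  have h2 : (1 + x) ^ (loopLength n + 1) ≤ 2 :=
    (pow_le_pow_right₀ (by linarith) (by omega)).trans (h1.trans hexp)
  have h3 : 9 / (1 + e) ^ (loopLength n + 1) ≤ 9 * b := by
    have hb1 : 1 / (n : ℝ) ≤ b := by
      rw [hb, one_div, ← Real.rpow_neg_one]
      exact Real.rpow_le_rpow_of_exponent_le hn1 (by norm_num)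
    calc 9 / (1 + e) ^ (loopLength n + 1) ≤ 9 / n := by gcongr
      _ = 9 * (1 / n) := by ring
      _ ≤ _ := by gcongr
  have h4 : 6 * R ^ 2 * (1 + x) ^ (loopLength n + 1) * (1 + 12 / e) / n ≤ 3900 * b := by
    have h5 : 1 + 12 / e ≤ 13 / e := by
      have : 1 ≤ 1 / e := by rw [one_le_div he0]; exact he1
      rw [show (13 : ℝ) / e = 1 / e + 12 / e by ring]
      linarith
    calc 6 * R ^ 2 * (1 + x) ^ (loopLength n + 1) * (1 + 12 / e) / n
        ≤ 6 * (25 * a ^ 2) * 2 * (13 / e) / n := by gcongr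
      _ = 3900 * (a ^ 2 / (e * n)) := by field_simp; norm_num
      _ = _ := by rw [hkey]
  refine add_le_add h1 ?_
  calc _ ≤ 2 * (5 * a) * n * (9 * b + 3900 * b) ^ 2 := by gcongr
    _ = 10 * 3909 ^ 2 * (a * n * b ^ 2) := by ring
    _ = _ := by rw [hkey2]

theorem tendsto_prob_hasUnicycle {m : ℕ → ℕ}
    (hm : ∀ᶠ n : ℕ in atTop, (1 + (n : ℝ) ^ (-(1 / 10) : ℝ)) * n ≤ m n) :
    Tendsto (fun n : ℕ => prob n 2 0 (m n) fun F => HasUnicycle (implicationDigraph F)) atTop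
      (𝓝 1) := by
  have hlim1 : Tendsto (fun n : ℕ => 1 - 100 * (n : ℝ) ^ (-(7 / 9) : ℝ)) atTop (𝓝 1) := by
    have := ((tendsto_natCast_rpow_neg (show (0 : ℝ) < 7 / 9 by norm_num)).const_mul
      100).const_sub 1
    simpa using this
  have hlim2 : Tendsto (fun n : ℕ => Real.exp (1200 * (n : ℝ) ^ (-(61 / 90) : ℝ)) +
      10 * 3909 ^ 2 * (n : ℝ) ^ (-(11 / 45) : ℝ)) atTop (𝓝 1) := by
    have h1 := ((tendsto_natCast_rpow_neg (show (0 : ℝ) < 61 / 90 by norm_num)).const_mul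
      1200).rexp
    have h2 := (tendsto_natCast_rpow_neg (show (0 : ℝ) < 11 / 45 by norm_num)).const_mul
      (10 * 3909 ^ 2)
    simpa using h1.add h2
  have hlim : Tendsto (fun n : ℕ => (1 - 100 * (n : ℝ) ^ (-(7 / 9) : ℝ)) ^ 2 /
      (Real.exp (1200 * (n : ℝ) ^ (-(61 / 90) : ℝ)) +
        10 * 3909 ^ 2 * (n : ℝ) ^ (-(11 / 45) : ℝ))) atTop (𝓝 1) := by
    have := (hlim1.pow 2).div hlim2 one_ne_zero
    rwa [one_pow, div_one] at this
  refine tendsto_of_tendsto_of_tendsto_of_le_of_le' hlim tendsto_const_nhds ?_ ?_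
  · filter_upwards [hm, eventually_error_le, eventually_ge_atTop 1,
      hlim1.eventually_const_le (show (0 : ℝ) < 1 by norm_num)] with n hmn herr hn hnn
    have hn1 : (1 : ℝ) ≤ n := by exact_mod_cast hn
    have hn0 : (0 : ℝ) < n := by linarith
    have hup := loopLength_add_one_le hn
    have hlo := le_loopLength_add_one n
    have h1 : 4 * ((loopLength n : ℝ) + 1) ^ 2 / n ≤ 100 * (n : ℝ) ^ (-(7 / 9) : ℝ) := by
      have h2 : (n : ℝ) ^ (-(7 / 9) : ℝ) = ((n : ℝ) ^ (1 / 9 : ℝ)) ^ 2 / n := by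
        rw [eq_div_iff hn0.ne', ← Real.rpow_natCast, ← Real.rpow_mul hn0.le,
          ← Real.rpow_add_one hn0.ne']
        norm_num
      rw [h2, ← mul_div_assoc]
      have h3 : 0 < (n : ℝ) ^ (1 / 9 : ℝ) := by positivity
      exact div_le_div_of_nonneg_right (by nlinarith) hn0.le
    have h2 : 4 * ((loopLength n : ℝ) + 1) ^ 2 ≤ n := by
      have h3 : 4 * ((loopLength n : ℝ) + 1) ^ 2 / n ≤ 1 := by linarith
      rwa [div_le_one hn0] at h3
    have h3 : 2 ≤ (n : ℝ) ^ (-(1 / 10) : ℝ) * ((loopLength n : ℝ) + 1) := by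
      have h4 : (1 : ℝ) ≤ (n : ℝ) ^ (-(1 / 10) : ℝ) * (n : ℝ) ^ (1 / 9 : ℝ) := by
        rw [← Real.rpow_add hn0]
        exact Real.one_le_rpow hn1 (by norm_num)
      have h5 : 0 ≤ (n : ℝ) ^ (-(1 / 10) : ℝ) := by positivity
      nlinarith
    have h4 := sq_one_sub_le_prob_mul (even_loopLength n) (by rw [loopLength]; omega) h2
      (show 0 < (n : ℝ) ^ (-(1 / 10) : ℝ) by positivity) hmn h3
    rw [div_le_iff₀ (by positivity)]
    refine le_trans ?_ (h4.trans (mul_le_mul_of_nonneg_left herr measureReal_nonneg))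
    exact pow_le_pow_left₀ hnn (by linarith) 2
  · filter_upwards [eventually_ge_atTop 2] with n hn
    exact prob_le_one hn 0 _

/-- The logarithmic factor is needed only through being eventually at least `1`. -/
theorem eventually_rpow_le_of_isLittleO {ε : ℕ → ℝ} (hε_pos : ∀ᶠ n in atTop, 0 < ε n)
    (hε : (fun n : ℕ => (n : ℝ) ^ (-0.1 : ℝ) * Real.log n ^ (0.9 : ℝ)) =o[atTop] ε) :
    ∀ᶠ n : ℕ in atTop, (n : ℝ) ^ (-(1 / 10) : ℝ) ≤ ε n := by
  have hlog : ∀ᶠ n : ℕ in atTop, 1 ≤ Real.log n :=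
    (Real.tendsto_log_atTop.comp tendsto_natCast_atTop_atTop).eventually_ge_atTop 1
  filter_upwards [hε_pos, hε.bound zero_lt_one, hlog] with n h1 h2 h3
  rw [one_mul, Real.norm_of_nonneg h1.le, Real.norm_of_nonneg (by positivity)] at h2
  refine le_trans ?_ h2
  have h4 : 1 ≤ Real.log n ^ (0.9 : ℝ) := Real.one_le_rpow h3 (by norm_num)
  rw [show (-0.1 : ℝ) = -(1 / 10) by norm_num]
  exact le_mul_of_one_le_right (by positivity) h4

end PolarizedSAT

theorem mainTheorem5 (ε : ℕ → ℝ) (m : ℕ → ℕ)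
    (hε_pos : ∀ᶠ n in atTop, 0 < ε n)
    (hε_lt : ∀ᶠ n in atTop, ε n < 1 / 2)
    (hε_large : (fun n : ℕ => (n : ℝ) ^ (-0.1 : ℝ) * Real.log n ^ (0.9 : ℝ)) =o[atTop] ε)
    (hm : ∀ᶠ n in atTop, (1 + ε n) * n < m n) :
    Tendsto (fun n : ℕ => PolarizedSAT.prob n 2 0 (m n) fun F =>
        PolarizedSAT.HasUnicycle (PolarizedSAT.implicationDigraph F)) atTop (𝓝 1) ∧
      Tendsto (fun n : ℕ => PolarizedSAT.prob n 2 0 (m n) fun F => ¬ F.Satisfiable)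
        atTop (𝓝 1) := by
  have h1 := PolarizedSAT.tendsto_prob_hasUnicycle (m := m) (by
    filter_upwards [hm, PolarizedSAT.eventually_rpow_le_of_isLittleO hε_pos hε_large] with n h2 h3
    exact le_trans (by gcongr) h2.le)
  refine ⟨h1, tendsto_of_tendsto_of_tendsto_of_le_of_le' h1 tendsto_const_nhds ?_ ?_⟩
  · filter_upwards [eventually_ge_atTop 2] with n hn
    exact PolarizedSAT.prob_mono hn 0 PolarizedSAT.not_satisfiable_of_hasUnicycle
  · filter_upwards [eventually_ge_atTop 2] with n hn
    exact PolarizedSAT.prob_le_one hn 0 _
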